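/- Let $\Gamma,Q,\Sigma_0\in\mathbb R^{d\times d}$ with $Q,\Sigma_0\succeq 0$ and let $\sigma>0$. Let $$z_{t+1}=\Gamma z_t+\xi_t,\qquad z_0\sim\mathcal N(0,\Sigma_0),\qquad X_t=\langle a_t,z_t\rangle+\eta_t\qquad(t=0,1,2,\dots),$$ with $\xi_t\sim\mathcal N(0,Q)$ i.i.d., $\eta_t\sim\mathcal N(0,\sigma^2)$ i.i.d., and $z_0$, $(\xi_t)_t$, $(\eta_t)_t$ independent. The actions lie in $\mathcal A=\{a\in\mathbb R^d:\|a\|_2=1\}$, and $a_t$ is a measurable function of $X_0,\dots,X_{t-1}$ and, possibly, of a random seed independent of $z_0,(\xi_t)_t,(\eta_t)_t$. Let $$R_n=\sum_{t=1}^n\mathbb E[X_t^*-X_t],\qquad X_t^*=\max_{a\in\mathcal A}\langle a,z_t\rangle ,\qquad Z_t=\mathbb E[z_tz_t^\top],$$ let $P_{t|t-1}$ be the error covariance matrix of the Kalman filter along the chosen actions, that is $P_{0|-1}=\Sigma_0$ and $$P_{t+1|t}=\Gamma P_{t|t-1}\Gamma^\top+Q-\Gamma P_{t|t-1}a_t\,(a_t^\top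 P_{t|t-1}a_t+\sigma^2)^{-1}a_t^\top P_{t|t-1}\Gamma^\top ,$$ and let $\nu,\hat\nu\sim\mathcal N(0,I_d)$. The expectations in $R_n$ exist, and the following hold. (a) Let $n\ge 0$ and let $P'$ be a matrix such that almost surely $P_{t|t-1}\succeq P'$ for $t=1,\dots,n$. Then $$R_n\ \ge\ \sum_{t=1}^n\Big(\mathbb E\big[\sqrt{\nu^\top Z_t\nu}\big]-\mathbb E\big[\sqrt{\hat\nu^\top(Z_t-P')\hat\nu}\big]\Big).$$ (b) Suppose that $\rho(\Gamma)<1$, that $Z_t\to Z$, and that $P_{t|t-1}\to P$ almost surely, as $t\to\infty$. Put $c=\mathbb E[\sqrt{\nu^\top Z\nu}]-\mathbb E[\sqrt{\hat\nu^\top(Z-P)\hat\nu}]$. Then, asymptotically, $R_n\ge\sum_{t=1}^n c-o(n)$: for every $\varepsilon>0$, $R_n\ge\sum_{t=1}^n c-\varepsilon n$ for all sufficiently large $n$. Moreover, $R_n\ge\sum_{t=1}^n c$ exactly, for every $n$ such that $Z_t\preceq Z$ and, almost surely, $P_{t|t-1}\succeq P$ for $t=1,\dots,n$ (in particular in the stationary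 regime $Z_t=Z$, $P_{t|t-1}=P$). If the pair $(\Gamma,Q^{1/2})$ is controllable, then $c>0$, so the regret grows at least linearly. -/

import Mathlib

open MeasureTheory ProbabilityTheory Filter Topology

noncomputable section

/-- The state space `ℝ^d` with its Euclidean norm. -/
abbrev EuclVec (d : ℕ) : Type := EuclideanSpace ℝ (Fin d)

/-- The quadratic form `vᵀ M v`. -/
def quadForm {d : ℕ} (M : Matrix (Fin d) (Fin d) ℝ) (v : EuclVec d) : ℝ :=
  v.ofLp ⬝ᵥ M.mulVec v.ofLp

/-- `E [√(νᵀ M ν)]` for a standard Gaussian vector `ν ∼ N(0, I_d)`. -/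
def expSqrtQuad {d : ℕ} (M : Matrix (Fin d) (Fin d) ℝ) : ℝ :=
  ∫ v, √(quadForm M v) ∂(stdGaussian (EuclVec d))

/-- One step of the Kalman (Riccati) recursion for the covariance of the one-step prediction error:
`g(P, a) = Γ P Γᵀ + Q - Γ P a (aᵀ P a + σ²)⁻¹ aᵀ P Γᵀ`. -/
def riccatiStep {d : ℕ} (Γ Q : Matrix (Fin d) (Fin d) ℝ) (σ : ℝ)
    (P : Matrix (Fin d) (Fin d) ℝ) (a : EuclVec d) : Matrix (Fin d) (Fin d) ℝ :=
  Γ * P * Γ.transpose + Q -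
    (quadForm P a + σ ^ 2)⁻¹ • (Γ * P * Matrix.vecMulVec a.ofLp a.ofLp * P * Γ.transpose)

/-- The Kalman filter's error covariance matrices along a sequence of actions:
`kalmanCov Γ Q S₀ σ a t` is `P_{t|t-1}`, with `P_{0|-1} = S₀` and
`P_{t+1|t} = g(P_{t|t-1}, a_t)`. -/
def kalmanCov {d : ℕ} (Γ Q S₀ : Matrix (Fin d) (Fin d) ℝ) (σ : ℝ) (a : ℕ → EuclVec d) :
    ℕ → Matrix (Fin d) (Fin d) ℝ
  | 0 => S₀
  | t + 1 => riccatiStep Γ Q σ (kalmanCov Γ Q S₀ σ a t) (a t)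

/-- The information available before round `t`: a random seed `U` of the learner and the rewards
`X_0, …, X_{t-1}` observed so far. -/
abbrev history {Ω S : Type*} [MeasurableSpace S] (U : Ω → S) (X : ℕ → Ω → ℝ) (t : ℕ) :
    MeasurableSpace Ω :=
  MeasurableSpace.comap U inferInstance ⊔
    ⨆ s ∈ Finset.range t, MeasurableSpace.comap (X s) inferInstance

/-- A linear bandit with actions on the unit sphere of `ℝ^d`, whose parameter vector is the state of
a linear Gaussian dynamical system, together with a learner. The learner's action of round `t` is a
(measurable) function of the rewards of the earlier rounds and of a random seed `U` that is
independent of the environment; a constant `U` gives the deterministic policies. -/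
structure IsLGDSBandit {d : ℕ} {Ω S : Type*} [MeasurableSpace Ω] [MeasurableSpace S]
    (μ : Measure Ω) (Γ Q S₀ : Matrix (Fin d) (Fin d) ℝ) (σ : ℝ) (U : Ω → S)
    (z ξ : ℕ → Ω → EuclVec d) (η : ℕ → Ω → ℝ) (a : ℕ → Ω → EuclVec d) (X : ℕ → Ω → ℝ) :
    Prop where
  posSemidef_Q : Q.PosSemidef
  posSemidef_S₀ : S₀.PosSemidef
  sigma_pos : 0 < σ
  measurable_U : Measurable U
  measurable_z₀ : Measurable (z 0)
  measurable_ξ : ∀ t, Measurable (ξ t)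
  measurable_η : ∀ t, Measurable (η t)
  law_z₀ : HasLaw (z 0) (multivariateGaussian 0 S₀) μ
  law_ξ : ∀ t, HasLaw (ξ t) (multivariateGaussian 0 Q) μ
  law_η : ∀ t, HasLaw (η t) (gaussianReal 0 (Real.toNNReal (σ ^ 2))) μ
  /-- The seed, the initial state, the process noise and the measurement noise are independent. -/
  indep_seed : IndepFun U (fun ω => (z 0 ω, (fun t => ξ t ω), (fun t => η t ω))) μ
  indep_init : IndepFun (z 0) (fun ω => ((fun t => ξ t ω), (fun t => η t ω))) μ
  indep_noises : IndepFun (fun ω t => ξ t ω) (fun ω t => η t ω) μ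
  iIndep_ξ : iIndepFun ξ μ
  iIndep_η : iIndepFun η μ
  state_step : ∀ t ω, z (t + 1) ω = WithLp.toLp 2 (Γ.mulVec (z t ω).ofLp) + ξ t ω
  reward_eq : ∀ t ω, X t ω = inner ℝ (a t ω) (z t ω) + η t ω
  action_mem : ∀ t ω, a t ω ∈ Metric.sphere (0 : EuclVec d) 1
  action_adapted : ∀ t, Measurable[history U X t] (a t)

/-- `Z_t = E[z_t z_tᵀ]`. -/
def stateCov {d : ℕ} {Ω : Type*} [MeasurableSpace Ω] (μ : Measure Ω)
    (z : ℕ → Ω → EuclVec d) (t : ℕ) : Matrix (Fin d) (Fin d) ℝ :=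
  Matrix.of fun i j => ∫ ω, z t ω i * z t ω j ∂μ

/-- The highest possible reward `X_t^* = max_{‖a‖ = 1} ⟨a, z_t⟩` of round `t`. -/
def bestReward {d : ℕ} {Ω : Type*} (z : ℕ → Ω → EuclVec d) (t : ℕ) (ω : Ω) : ℝ :=
  ⨆ a : Metric.sphere (0 : EuclVec d) 1, inner ℝ (a : EuclVec d) (z t ω)

/-- The regret `R_n = ∑_{t=1}^n E[X_t^* - X_t]`. -/
def regret {d : ℕ} {Ω : Type*} [MeasurableSpace Ω] (μ : Measure Ω)
    (z : ℕ → Ω → EuclVec d) (X : ℕ → Ω → ℝ) (n : ℕ) : ℝ :=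
  ∑ t ∈ Finset.Icc 1 n, ∫ ω, (bestReward z t ω - X t ω) ∂μ

/-- Controllability of the pair `(A, B)`: the matrix `[B, A B, …, A^{d-1} B]` has rank `d`. -/
def IsControllable {d : ℕ} (A B : Matrix (Fin d) (Fin d) ℝ) : Prop :=
  (Matrix.of fun (i : Fin d) (p : Fin d × Fin d) => (A ^ (p.1 : ℕ) * B) i p.2).rank = d

open scoped MatrixOrder in
/-- The positive semidefinite square root `Q^{1/2}` of a positive semidefinite matrix. -/
def psdSqrt {d : ℕ} (Q : Matrix (Fin d) (Fin d) ℝ) : Matrix (Fin d) (Fin d) ℝ :=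
  CFC.sqrt Q

end

/-! ### Quadratic forms and positive semidefinite matrices -/

section QuadForm

variable {d : ℕ}

/-! Over the unit sphere the best reward is `‖z_t‖`, and `z_t ∼ N(0, Z_t)`, so its expectation is
`expSqrtQuad Z_t`. Given the history, `z_t` is Gaussian with the Kalman mean `m_t` and covariance
`P_t = P_{t|t-1}` (`hasCondCharFun_state`). As `a_t` depends on the history only, the expected
reward is `E⟨a_t, m_t⟩ ≤ E‖m_t‖` (`le_instantaneous_regret`). What remains is an upper bound for
`E‖m_t‖`.

Since `P_t` depends on random actions, `m_t` need not be Gaussian. But averaging the conditional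
characteristic functions gives `E exp(i⟨u, m_t⟩ - uᵀ P_t u / 2) = exp(-uᵀ Z_t u / 2)`. If `P_t ⪰ P'`
almost surely, multiplying by the deterministic factor `exp(uᵀ P' u / 2)` shows that the mixture of
the laws `N(m_t, P_t - P')` is `N(0, Z_t - P')`. Jensen's inequality in each component yields
`E‖m_t‖ ≤ expSqrtQuad (Z_t - P')` (`integral_norm_le_of_gaussian_mixture`), which is (a).

For (b), `P_t → P` turns the same identity into convergence of `m_t` in law to `N(0, Z - P)`
(`tendsto_charFun_mean`). The second moments are bounded by `tr Z_t`, so `limsup E‖m_t‖ ≤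
expSqrtQuad (Z - P)`, and summing over rounds costs `o(n)`. The exact version follows from (a),
because `x ↦ √x - √(x - p)` is antitone. Positivity of the rate comes from `P ⪰ Q ≠ 0`.

Conditional Gaussianity is proved with characteristic functions alone: tested against `exp(i l X_t)`
on events of the history, the Kalman update is the completion of a square
(`gaussianCharFun_update`). -/

lemma quadForm_eq_inner (M : Matrix (Fin d) (Fin d) ℝ) (v : EuclVec d) :
    quadForm M v = inner ℝ v (Matrix.toEuclideanCLM (𝕜 := ℝ) M v) := by
  rw [Matrix.inner_toEuclideanCLM, quadForm]

lemma quadForm_add (M N : Matrix (Fin d) (Fin d) ℝ) (v : EuclVec d) :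
    quadForm (M + N) v = quadForm M v + quadForm N v := by
  simp [quadForm, Matrix.add_mulVec, dotProduct_add]

lemma quadForm_sub (M N : Matrix (Fin d) (Fin d) ℝ) (v : EuclVec d) :
    quadForm (M - N) v = quadForm M v - quadForm N v := by
  simp [quadForm, Matrix.sub_mulVec, dotProduct_sub]

lemma quadForm_smul (c : ℝ) (M : Matrix (Fin d) (Fin d) ℝ) (v : EuclVec d) :
    quadForm (c • M) v = c * quadForm M v := by
  simp [quadForm, Matrix.smul_mulVec]

lemma quadForm_eq_sum (M : Matrix (Fin d) (Fin d) ℝ) (v : EuclVec d) :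
    quadForm M v = ∑ i, ∑ j, v i * (M i j * v j) := by
  simp [quadForm, dotProduct, Matrix.mulVec, Finset.mul_sum]

lemma posSemidef_iff_quadForm_nonneg {M : Matrix (Fin d) (Fin d) ℝ} :
    M.PosSemidef ↔ M.IsHermitian ∧ ∀ v, 0 ≤ quadForm M v := by
  rw [Matrix.posSemidef_iff_dotProduct_mulVec]
  refine and_congr_right fun _ => ⟨fun h v => by simpa [quadForm] using h v.ofLp, fun h x => ?_⟩
  simpa [quadForm] using h (WithLp.toLp 2 x)

lemma Matrix.PosSemidef.quadForm_nonneg {M : Matrix (Fin d) (Fin d) ℝ} (hM : M.PosSemidef)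
    (v : EuclVec d) : 0 ≤ quadForm M v :=
  (posSemidef_iff_quadForm_nonneg.1 hM).2 v

lemma inner_toEuclideanCLM_transpose (M : Matrix (Fin d) (Fin d) ℝ) (u v : EuclVec d) :
    inner ℝ (Matrix.toEuclideanCLM (𝕜 := ℝ) M.transpose u) v =
      inner ℝ u (Matrix.toEuclideanCLM (𝕜 := ℝ) M v) := by
  rw [Matrix.inner_toEuclideanCLM, real_inner_comm, Matrix.inner_toEuclideanCLM,
    Matrix.mulVec_transpose, dotProduct_comm, Matrix.dotProduct_mulVec]

lemma inner_toEuclideanCLM_comm {M : Matrix (Fin d) (Fin d) ℝ} (hM : M.IsHermitian)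
    (u v : EuclVec d) :
    inner ℝ (Matrix.toEuclideanCLM (𝕜 := ℝ) M u) v =
      inner ℝ u (Matrix.toEuclideanCLM (𝕜 := ℝ) M v) := by
  have h := inner_toEuclideanCLM_transpose M u v
  rwa [← Matrix.conjTranspose_eq_transpose_of_trivial, hM.eq] at h

lemma quadForm_add_smul {M : Matrix (Fin d) (Fin d) ℝ} (hM : M.IsHermitian) (x a : EuclVec d)
    (c : ℝ) :
    quadForm M (x + c • a) = quadForm M x
      + 2 * c * inner ℝ x (Matrix.toEuclideanCLM (𝕜 := ℝ) M a) + c ^ 2 * quadForm M a := by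
  simp only [quadForm_eq_inner, map_add, map_smul, inner_add_left, inner_add_right,
    real_inner_smul_left, real_inner_smul_right]
  rw [← inner_toEuclideanCLM_comm hM a x, real_inner_comm x]
  ring

lemma quadForm_smul_vec (M : Matrix (Fin d) (Fin d) ℝ) (c : ℝ) (a : EuclVec d) :
    quadForm M (c • a) = c ^ 2 * quadForm M a := by
  simp only [quadForm_eq_inner, map_smul, real_inner_smul_left, real_inner_smul_right]
  ring

/-- The Cauchy–Schwarz inequality for the form of a positive semidefinite matrix. -/
lemma Matrix.PosSemidef.inner_sq_le {M : Matrix (Fin d) (Fin d) ℝ} (hM : M.PosSemidef)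
    (x a : EuclVec d) :
    inner ℝ x (Matrix.toEuclideanCLM (𝕜 := ℝ) M a) ^ 2 ≤ quadForm M x * quadForm M a := by
  have h := discrim_le_zero (a := quadForm M a)
    (b := 2 * inner ℝ x (Matrix.toEuclideanCLM (𝕜 := ℝ) M a)) (c := quadForm M x) fun c => by
      have := hM.quadForm_nonneg (x + c • a)
      rw [quadForm_add_smul hM.isHermitian] at this
      linarith
  rw [discrim] at h
  linarith

lemma toEuclideanCLM_vecMulVec (a v : EuclVec d) :
    Matrix.toEuclideanCLM (𝕜 := ℝ) (Matrix.vecMulVec a.ofLp a.ofLp) v = inner ℝ a v • a := by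
  ext i
  simp [Matrix.ofLp_toEuclideanCLM, Matrix.vecMulVec_mulVec, PiLp.inner_apply, dotProduct, mul_comm]

lemma quadForm_mul_mul_transpose (Γ P : Matrix (Fin d) (Fin d) ℝ) (u : EuclVec d) :
    quadForm (Γ * P * Γ.transpose) u =
      quadForm P (Matrix.toEuclideanCLM (𝕜 := ℝ) Γ.transpose u) := by
  rw [quadForm_eq_inner, quadForm_eq_inner, inner_toEuclideanCLM_transpose]
  simp [map_mul]

lemma quadForm_riccatiStep {Γ Q P : Matrix (Fin d) (Fin d) ℝ} (hP : P.IsHermitian) (σ : ℝ)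
    (a u : EuclVec d) :
    quadForm (riccatiStep Γ Q σ P a) u =
      quadForm P (Matrix.toEuclideanCLM (𝕜 := ℝ) Γ.transpose u) + quadForm Q u
        - (quadForm P a + σ ^ 2)⁻¹ * inner ℝ (Matrix.toEuclideanCLM (𝕜 := ℝ) Γ.transpose u)
          (Matrix.toEuclideanCLM (𝕜 := ℝ) P a) ^ 2 := by
  have h : quadForm (Γ * P * Matrix.vecMulVec a.ofLp a.ofLp * P * Γ.transpose) u =
      inner ℝ (Matrix.toEuclideanCLM (𝕜 := ℝ) Γ.transpose u)
        (Matrix.toEuclideanCLM (𝕜 := ℝ) P a) ^ 2 := by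
    rw [show Γ * P * Matrix.vecMulVec a.ofLp a.ofLp * P * Γ.transpose =
      Γ * (P * Matrix.vecMulVec a.ofLp a.ofLp * P) * Γ.transpose by simp only [Matrix.mul_assoc],
      quadForm_mul_mul_transpose, quadForm_eq_inner]
    simp only [map_mul, mul_apply_eq_comp, toEuclideanCLM_vecMulVec, map_smul,
      real_inner_smul_right]
    rw [← inner_toEuclideanCLM_comm hP a, real_inner_comm]
    ring
  rw [riccatiStep, quadForm_sub, quadForm_add, quadForm_smul, quadForm_mul_mul_transpose, h]

/-- By Cauchy–Schwarz for the form of `P`, the rank-one correction never exceeds `Γ P Γᵀ`. Hence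
each prediction covariance dominates `Q`, the fact that later makes the rate positive. -/
lemma posSemidef_riccatiStep_sub {Γ Q P : Matrix (Fin d) (Fin d) ℝ} (hP : P.PosSemidef) {σ : ℝ}
    (hσ : 0 < σ) (a : EuclVec d) : (riccatiStep Γ Q σ P a - Q).PosSemidef := by
  rw [posSemidef_iff_quadForm_nonneg]
  constructor
  · have hPt : P.transpose = P := by
      rw [← Matrix.conjTranspose_eq_transpose_of_trivial, hP.isHermitian.eq]
    rw [Matrix.IsHermitian, Matrix.conjTranspose_eq_transpose_of_trivial, riccatiStep,
      add_sub_right_comm, add_sub_cancel_right]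
    simp [Matrix.transpose_sub, Matrix.transpose_mul, hPt,
      Matrix.mul_assoc, Matrix.transpose_vecMulVec, Matrix.transpose_smul]
  · intro u
    rw [quadForm_sub, quadForm_riccatiStep hP.isHermitian]
    have h1 := hP.inner_sq_le (Matrix.toEuclideanCLM (𝕜 := ℝ) Γ.transpose u) a
    have h2 := hP.quadForm_nonneg a
    have h3 := hP.quadForm_nonneg (Matrix.toEuclideanCLM (𝕜 := ℝ) Γ.transpose u)
    have hs : 0 < quadForm P a + σ ^ 2 := by positivity
    have h4 : (quadForm P a + σ ^ 2)⁻¹ * inner ℝ (Matrix.toEuclideanCLM (𝕜 := ℝ) Γ.transpose u)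
          (Matrix.toEuclideanCLM (𝕜 := ℝ) P a) ^ 2 ≤
        quadForm P (Matrix.toEuclideanCLM (𝕜 := ℝ) Γ.transpose u) := by
      rw [inv_mul_le_iff₀ hs]
      nlinarith [mul_nonneg h3 (sq_nonneg σ)]
    linarith

lemma posSemidef_riccatiStep {Γ Q P : Matrix (Fin d) (Fin d) ℝ} (hP : P.PosSemidef)
    (hQ : Q.PosSemidef) {σ : ℝ} (hσ : 0 < σ) (a : EuclVec d) :
    (riccatiStep Γ Q σ P a).PosSemidef := by
  simpa using (posSemidef_riccatiStep_sub (Γ := Γ) (Q := Q) hP hσ a).add hQ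

lemma posSemidef_kalmanCov {Γ Q S₀ : Matrix (Fin d) (Fin d) ℝ} (hS₀ : S₀.PosSemidef)
    (hQ : Q.PosSemidef) {σ : ℝ} (hσ : 0 < σ) (a : ℕ → EuclVec d) (t : ℕ) :
    (kalmanCov Γ Q S₀ σ a t).PosSemidef := by
  induction t with
  | zero => exact hS₀
  | succ t ih => exact posSemidef_riccatiStep ih hQ hσ _

lemma posSemidef_kalmanCov_succ_sub {Γ Q S₀ : Matrix (Fin d) (Fin d) ℝ} (hS₀ : S₀.PosSemidef)
    (hQ : Q.PosSemidef) {σ : ℝ} (hσ : 0 < σ) (a : ℕ → EuclVec d) (t : ℕ) :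
    (kalmanCov Γ Q S₀ σ a (t + 1) - Q).PosSemidef :=
  posSemidef_riccatiStep_sub (posSemidef_kalmanCov hS₀ hQ hσ a t) hσ _

@[fun_prop]
lemma continuous_quadForm (M : Matrix (Fin d) (Fin d) ℝ) : Continuous (quadForm M) := by
  simp only [funext (quadForm_eq_inner M)]
  fun_prop

lemma continuous_quadForm_left (v : EuclVec d) :
    Continuous fun M : Matrix (Fin d) (Fin d) ℝ => quadForm M v := by
  simp only [quadForm_eq_sum]
  fun_prop

lemma isClosed_posSemidef : IsClosed {M : Matrix (Fin d) (Fin d) ℝ | M.PosSemidef} := by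
  simp only [posSemidef_iff_quadForm_nonneg, Set.ofPred_and, Set.ofPred_forall]
  refine IsClosed.inter (isClosed_eq (by fun_prop) continuous_id) (isClosed_iInter fun v => ?_)
  exact isClosed_le continuous_const (continuous_quadForm_left v)

open scoped MatrixOrder in
-- This identifies `expSqrtQuad S` with the expected norm of an `N(0, S)` vector.
lemma norm_toEuclideanCLM_sqrt {S : Matrix (Fin d) (Fin d) ℝ} (hS : S.PosSemidef)
    (v : EuclVec d) :
    ‖Matrix.toEuclideanCLM (𝕜 := ℝ) (CFC.sqrt S) v‖ = √(quadForm S v) := by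
  have hsa : (CFC.sqrt S).IsHermitian :=
    (Matrix.nonneg_iff_posSemidef.1 (CFC.sqrt_nonneg S)).isHermitian
  rw [norm_eq_sqrt_real_inner, inner_toEuclideanCLM_comm hsa, ← mul_apply_eq_comp,
    ← map_mul, CFC.sqrt_mul_sqrt_self S hS.nonneg, quadForm_eq_inner]

open scoped MatrixOrder in
/-- The square root of a measurable family of matrices is measurable: on the closed set of positive
semidefinite matrices it is the inverse of the continuous injective map `B ↦ B * B`. -/
lemma measurable_sqrt_apply {α : Type*} [MeasurableSpace α] {C : α → Matrix (Fin d) (Fin d) ℝ}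
    (hC : ∀ i j, Measurable fun x => C x i j) (i j : Fin d) :
    Measurable fun x => CFC.sqrt (C x) i j := by
  let _ : MeasurableSpace (Matrix (Fin d) (Fin d) ℝ) :=
    inferInstanceAs (MeasurableSpace (Fin d → Fin d → ℝ))
  have _ : BorelSpace (Matrix (Fin d) (Fin d) ℝ) :=
    inferInstanceAs (BorelSpace (Fin d → Fin d → ℝ))
  have _ : PolishSpace (Matrix (Fin d) (Fin d) ℝ) :=
    inferInstanceAs (PolishSpace (Fin d → Fin d → ℝ))
  have hCm : Measurable C := measurable_pi_lambda _ fun i => measurable_pi_lambda _ fun j => hC i j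
  let K : Set (Matrix (Fin d) (Fin d) ℝ) := {M | M.PosSemidef}
  have hK : IsClosed K := isClosed_posSemidef
  have _ : PolishSpace K := hK.polishSpace
  let f : K → Matrix (Fin d) (Fin d) ℝ := fun B => B.1 * B.1
  have hf : MeasurableEmbedding f := by
    refine Continuous.measurableEmbedding (by fun_prop) fun A B hAB => Subtype.ext ?_
    rw [← CFC.sqrt_mul_self A.1 A.2.nonneg, ← CFC.sqrt_mul_self B.1 B.2.nonneg]
    exact congrArg CFC.sqrt hAB
  let g : α → K := fun x => ⟨CFC.sqrt (C x), Matrix.nonneg_iff_posSemidef.1 (CFC.sqrt_nonneg _)⟩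
  -- Off the positive semidefinite cone `CFC.sqrt` has the default value `0`, so its square is `C`
  -- cut off to the cone.
  have hfg : f ∘ g = (C ⁻¹' K).indicator C := by
    ext1 x
    by_cases hx : (C x).PosSemidef
    · rw [Set.indicator_of_mem (show x ∈ C ⁻¹' K from hx)]
      exact CFC.sqrt_mul_sqrt_self _ hx.nonneg
    · rw [Set.indicator_of_notMem (show x ∉ C ⁻¹' K from hx)]
      have : CFC.sqrt (C x) = 0 :=
        CFC.sqrt_of_not_nonneg fun h => hx (Matrix.nonneg_iff_posSemidef.1 h)
      simp [f, g, this]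
  have hg : Measurable g := by
    rw [← hf.measurable_comp_iff, hfg]
    exact hCm.indicator (hCm hK.measurableSet)
  exact (measurable_pi_apply j).comp ((measurable_pi_apply i).comp (measurable_subtype_coe.comp hg))

end QuadForm

/-! ### Conditional characteristic functions -/

/-- Weight and direction are approximated together, so that the pair has finitely many values and a
random direction becomes constant on each piece. -/
lemma exists_finite_range_approx {Ω E : Type*} {m : MeasurableSpace Ω}
    [NormedAddCommGroup E] [MeasurableSpace E] [BorelSpace E] [SecondCountableTopology E]
    {W : Ω → ℂ} (hW : Measurable W) {C : ℝ}
    (hWb : ∀ ω, ‖W ω‖ ≤ C) {V : Ω → E} (hV : Measurable V) :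
    ∃ (W' : ℕ → Ω → ℂ) (V' : ℕ → Ω → E), (∀ n, Measurable (W' n)) ∧ (∀ n, Measurable (V' n)) ∧
      (∀ n, (Set.range fun ω => (W' n ω, V' n ω)).Finite) ∧ (∀ n ω, ‖W' n ω‖ ≤ C) ∧
      (∀ ω, Tendsto (W' · ω) atTop (𝓝 (W ω))) ∧ ∀ ω, Tendsto (V' · ω) atTop (𝓝 (V ω)) := by
  have hWs : StronglyMeasurable W := hW.stronglyMeasurable
  have hVs : StronglyMeasurable V := hV.stronglyMeasurable
  exact ⟨fun n => hWs.approxBounded C n, fun n => hVs.approx n,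
    fun n => (hWs.approxBounded C n).measurable, fun n => (hVs.approx n).measurable,
    fun n => ((hWs.approxBounded C n).pair (hVs.approx n)).finite_range,
    fun n ω => hWs.norm_approxBounded_le ((norm_nonneg _).trans (hWb ω)) n ω,
    fun ω => hWs.tendsto_approxBounded_of_norm_le (hWb ω), hVs.tendsto_approx⟩

section CondCharFun

variable {Ω E : Type*} [NormedAddCommGroup E] [InnerProductSpace ℝ E]

/-- `ψ u` is a version of the conditional expectation of `exp (i⟨u, z⟩)` given `F`, for every `u`,
except that `ψ u` is not required to be `F`-measurable. -/
def HasCondCharFun (F : MeasurableSpace Ω) {_mΩ : MeasurableSpace Ω} (μ : Measure Ω) (z : Ω → E)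
    (ψ : E → Ω → ℂ) : Prop :=
  ∀ u A, MeasurableSet[F] A →
    ∫ ω in A, Complex.exp (inner ℝ u (z ω) * Complex.I) ∂μ = ∫ ω in A, ψ u ω ∂μ

lemma norm_cexp_real_mul_I (x : ℝ) : ‖Complex.exp (x * Complex.I)‖ ≤ 1 :=
  (Complex.norm_exp_ofReal_mul_I x).le

lemma integral_comp_of_finite_range {β : Type*} [MeasurableSpace Ω] {μ : Measure Ω} {p : Ω → β}
    (hp : (Set.range p).Finite) (hm : ∀ x, MeasurableSet (p ⁻¹' {x})) {H : β → Ω → ℂ}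
    (hH : ∀ x, Integrable (H x) μ) :
    ∫ ω, H (p ω) ω ∂μ = ∑ x ∈ hp.toFinset, ∫ ω in p ⁻¹' {x}, H x ω ∂μ := by
  classical
  have h : (fun ω => H (p ω) ω) =
      fun ω => ∑ x ∈ hp.toFinset, (p ⁻¹' {x}).indicator (H x) ω := by
    ext ω
    rw [Finset.sum_eq_single (p ω)]
    · simp
    · exact fun x _ hx => Set.indicator_of_notMem (by simpa using hx.symm) _
    · exact fun hx => absurd (by simp) hx
  rw [h, integral_finsetSum _ fun x _ => (hH x).indicator (hm x)]
  exact Finset.sum_congr rfl fun x _ => integral_indicator (hm x)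

variable [MeasurableSpace E] [BorelSpace E] [SecondCountableTopology E]

/-- A conditional characteristic function may be evaluated in a random direction which is measurable
with respect to the conditioning σ-algebra. -/
lemma HasCondCharFun.integral_mul_eq {F mΩ : MeasurableSpace Ω} (hF : F ≤ mΩ) {μ : Measure Ω}
    [IsFiniteMeasure μ] {z : Ω → E} (hz : Measurable z) {ψ : E → Ω → ℂ}
    (h : HasCondCharFun F μ z ψ) (hψm : ∀ u, Measurable (ψ u)) (hψc : ∀ ω, Continuous (ψ · ω))
    (hψb : ∀ u ω, ‖ψ u ω‖ ≤ 1) {W : Ω → ℂ} (hW : Measurable[F] W) {C : ℝ}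
    (hWb : ∀ ω, ‖W ω‖ ≤ C) {V : Ω → E} (hV : Measurable[F] V) :
    ∫ ω, W ω * Complex.exp (inner ℝ (V ω) (z ω) * Complex.I) ∂μ = ∫ ω, W ω * ψ (V ω) ω ∂μ := by
  have hψ2 : Measurable (Function.uncurry ψ) :=
    (measurable_uncurry_of_continuous_of_measurable (u := fun u : E => ψ u)
      (by simpa using hψc) hψm)
  obtain ⟨W', V', hW', hV', hfin, hWb', hWt, hVt⟩ := exists_finite_range_approx hW hWb hV
  -- Both sides of the claim have the form treated here: dominated convergence reduces each to
  -- weights and directions of finite range.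
  have key : ∀ ψ' : E → Ω → ℂ, Measurable (Function.uncurry ψ') → (∀ ω, Continuous (ψ' · ω)) →
      (∀ u ω, ‖ψ' u ω‖ ≤ 1) →
      Tendsto (fun n => ∫ ω, W' n ω * ψ' (V' n ω) ω ∂μ) atTop
        (𝓝 (∫ ω, W ω * ψ' (V ω) ω ∂μ)) := by
    intro ψ' h2 hc hb
    refine tendsto_integral_of_dominated_convergence (fun _ => C) (fun n => ?_)
      (integrable_const C) (fun n => ae_of_all _ fun ω => ?_) (ae_of_all _ fun ω => ?_)
    · have h3 : Measurable (V' n) := (hV' n).mono hF le_rfl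
      have h4 : Measurable (W' n) := (hW' n).mono hF le_rfl
      exact (h4.mul (h2.comp (h3.prodMk measurable_id))).aestronglyMeasurable
    · rw [norm_mul]
      exact (mul_le_mul (hWb' n ω) (hb _ _) (norm_nonneg _)
        ((norm_nonneg _).trans (hWb ω))).trans_eq (mul_one C)
    · exact (hWt ω).mul (((hc ω).tendsto _).comp (hVt ω))
  refine tendsto_nhds_unique
    (key (fun u ω => Complex.exp (inner ℝ u (z ω) * Complex.I)) ?_ ?_ ?_) ?_
  · simp only [Function.uncurry_def]
    fun_prop
  · intro ω; fun_prop
  · exact fun u ω => norm_cexp_real_mul_I _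
  refine (key ψ hψ2 hψc hψb).congr fun n => ?_
  -- The level sets of the pair belong to `F`, so on each of them the defining identity applies with
  -- a fixed direction.
  have hp : ∀ x, MeasurableSet[F] ((fun ω => (W' n ω, V' n ω)) ⁻¹' {x}) := fun x =>
    ((hW' n).prodMk (hV' n)) (measurableSet_singleton x)
  have e1 := integral_comp_of_finite_range (hfin n) (fun x => hF _ (hp x)) (μ := μ)
    (H := fun x ω => x.1 * Complex.exp (inner ℝ x.2 (z ω) * Complex.I)) fun x => by
      refine Integrable.const_mul (Integrable.of_bound (C := 1) ?_ ?_) _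
      · fun_prop
      · exact ae_of_all _ fun ω => norm_cexp_real_mul_I _
  have e2 := integral_comp_of_finite_range (hfin n) (fun x => hF _ (hp x)) (μ := μ)
    (H := fun x ω => x.1 * ψ x.2 ω) fun x =>
    Integrable.const_mul (Integrable.of_bound (C := 1) (hψm _).aestronglyMeasurable
      (ae_of_all _ fun ω => hψb _ _)) _
  rw [e1, e2]
  refine Finset.sum_congr rfl fun x _ => ?_
  rw [integral_const_mul, integral_const_mul, h _ _ (hp x)]

lemma hasCondCharFun_of_indep {F mΩ : MeasurableSpace Ω} (hF : F ≤ mΩ) {μ : Measure Ω}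
    [IsProbabilityMeasure μ] {z : Ω → E} (hz : Measurable z)
    (h : Indep F (MeasurableSpace.comap z inferInstance) μ) :
    HasCondCharFun F μ z (fun u _ => charFun (μ.map z) u) := by
  intro u A hA
  have hi : IndepFun (A.indicator (fun _ => (1 : ℂ)))
      (fun ω => Complex.exp (inner ℝ u (z ω) * Complex.I)) μ := by
    rw [IndepFun_iff_Indep]
    refine indep_of_indep_of_le_left (indep_of_indep_of_le_right h ?_) ?_
    · have : Measurable fun x : E => Complex.exp (inner ℝ u x * Complex.I) := by fun_prop
      exact (this.comp (comap_measurable z)).comap_le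
    · exact (measurable_const.indicator hA).comap_le
  have h1 := hi.integral_fun_mul_eq_mul_integral
    (measurable_const.indicator (hF _ hA)).aestronglyMeasurable (by fun_prop)
  have h2 : ∀ f : Ω → ℂ, ∫ ω in A, f ω ∂μ = ∫ ω, A.indicator (fun _ => (1 : ℂ)) ω * f ω ∂μ := by
    intro f
    rw [← integral_indicator (hF _ hA)]
    congr with ω
    by_cases hω : ω ∈ A <;> simp [hω]
  rw [h2, h1, h2, integral_mul_const, charFun_apply, integral_map hz.aemeasurable (by fun_prop)]
  simp only [real_inner_comm u]

end CondCharFun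

/-! ### Enlarging the conditioning σ-algebra by one real observation -/

section Update

variable {Ω : Type*}

lemma generateFrom_inter_preimage {α : Type*} [MeasurableSpace α] (F : MeasurableSpace Ω)
    (X : Ω → α) : F ⊔ MeasurableSpace.comap X inferInstance =
      MeasurableSpace.generateFrom
        {s | ∃ A B, MeasurableSet[F] A ∧ MeasurableSet B ∧ s = A ∩ X ⁻¹' B} := by
  refine le_antisymm (sup_le (fun A hA => ?_) ?_) (MeasurableSpace.generateFrom_le ?_)
  · exact MeasurableSpace.measurableSet_generateFrom ⟨A, Set.univ, hA, .univ, by simp⟩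
  · rintro _ ⟨B, hB, rfl⟩
    exact MeasurableSpace.measurableSet_generateFrom ⟨Set.univ, B, .univ, hB, by simp⟩
  · rintro _ ⟨A, B, hA, hB, rfl⟩
    exact (le_sup_left (a := F) _ hA).inter (le_sup_right (a := F) _ ⟨B, hB, rfl⟩)

lemma isPiSystem_inter_preimage {α : Type*} [MeasurableSpace α] (F : MeasurableSpace Ω)
    (X : Ω → α) :
    IsPiSystem {s | ∃ A B, MeasurableSet[F] A ∧ MeasurableSet B ∧ s = A ∩ X ⁻¹' B} := by
  rintro _ ⟨A, B, hA, hB, rfl⟩ _ ⟨A', B', hA', hB', rfl⟩ _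
  refine ⟨A ∩ A', B ∩ B', hA.inter hA', hB.inter hB', ?_⟩
  rw [Set.preimage_inter, Set.inter_inter_inter_comm]

/-- Adding `C` makes `g` nonnegative. The measures with densities `C + g` and `C` then have images
under `X` with the same characteristic function, so these images coincide. -/
lemma setIntegral_preimage_eq_zero {mΩ : MeasurableSpace Ω} {μ : Measure Ω} [IsFiniteMeasure μ]
    {X : Ω → ℝ} (hX : Measurable X) {g : Ω → ℝ} (hg : Measurable g) {C : ℝ}
    (hgb : ∀ ω, |g ω| ≤ C)
    (h : ∀ l : ℝ, ∫ ω, Complex.exp (l * X ω * Complex.I) * (g ω : ℂ) ∂μ = 0) {B : Set ℝ}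
    (hB : MeasurableSet B) : ∫ ω in X ⁻¹' B, g ω ∂μ = 0 := by
  have hgi : Integrable g μ := Integrable.of_bound hg.aestronglyMeasurable C (ae_of_all _ hgb)
  have hpos : ∀ ω, 0 ≤ C + g ω := fun ω => by linarith [neg_le_of_abs_le (hgb ω)]
  have hm : ∀ f : Ω → ℝ, Measurable f → Measurable fun ω => ENNReal.ofReal (f ω) :=
    fun f hf => hf.ennreal_ofReal
  have hcf : ∀ f : Ω → ℝ, Measurable f → (∀ ω, 0 ≤ f ω) → ∀ l : ℝ,
      charFun ((μ.withDensity fun ω => ENNReal.ofReal (f ω)).map X) l =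
        ∫ ω, Complex.exp (l * X ω * Complex.I) * (f ω : ℂ) ∂μ := by
    intro f hf hf0 l
    rw [charFun_apply_real, integral_map hX.aemeasurable (by fun_prop),
      integral_withDensity_eq_integral_toReal_smul (hm f hf) (by simp)]
    congr with ω
    rw [ENNReal.toReal_ofReal (hf0 ω), Complex.real_smul, mul_comm]
  have hfin : ∀ f : Ω → ℝ, Integrable f μ →
      IsFiniteMeasure (μ.withDensity fun ω => ENNReal.ofReal (f ω)) := fun f hf =>
    isFiniteMeasure_withDensity_ofReal hf.2
  have _ := hfin (fun ω => C + g ω) ((integrable_const C).add hgi)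
  have _ := hfin (fun _ => |C|) (integrable_const _)
  -- Nonnegativity of `C` follows from the bound on `g` only if there is a point to evaluate at.
  by_cases hΩ : Nonempty Ω
  swap
  · have := not_nonempty_iff.1 hΩ
    simp [Measure.eq_zero_of_isEmpty μ]
  have hC : 0 ≤ C := (abs_nonneg _).trans (hgb hΩ.some)
  have heq : (μ.withDensity fun ω => ENNReal.ofReal (C + g ω)).map X =
      (μ.withDensity fun _ => ENNReal.ofReal |C|).map X := by
    refine Measure.ext_of_charFun (funext fun l => ?_)
    have hei : Integrable (fun ω => Complex.exp (l * X ω * Complex.I)) μ :=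
      Integrable.of_bound (by fun_prop) 1
        (ae_of_all _ fun ω => by simpa using norm_cexp_real_mul_I (l * X ω))
    rw [hcf _ (by fun_prop) hpos, hcf _ (by fun_prop) fun _ => abs_nonneg C, abs_of_nonneg hC]
    simp only [Complex.ofReal_add, mul_add]
    rw [integral_add (hei.mul_const _), h l, add_zero]
    refine (hgi.norm.mono' (by fun_prop) (ae_of_all _ fun ω => ?_))
    have := norm_cexp_real_mul_I (l * X ω)
    push_cast at this
    rw [norm_mul, Complex.norm_real]
    exact mul_le_of_le_one_left (norm_nonneg _) this
  have h1 := congrArg (fun ν => ν B) heq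
  simp only [Measure.map_apply hX hB, withDensity_apply _ (hX hB), abs_of_nonneg hC] at h1
  have h2 : ∫ ω in X ⁻¹' B, (C + g ω) ∂μ = ∫ ω in X ⁻¹' B, C ∂μ := by
    rw [integral_eq_lintegral_of_nonneg_ae (ae_of_all _ hpos) (by fun_prop),
      integral_eq_lintegral_of_nonneg_ae (ae_of_all _ fun _ => hC) (by fun_prop), h1]
  rw [integral_add (integrable_const C) hgi.integrableOn] at h2
  linarith

/-- A π-λ argument over the sets `A ∩ X ⁻¹' B`; on such a set the preceding lemma applies to `μ`
restricted to `A`. -/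
lemma setIntegral_eq_zero_of_sup_comap {F mΩ : MeasurableSpace Ω} (hF : F ≤ mΩ) {μ : Measure Ω}
    [IsFiniteMeasure μ] {X : Ω → ℝ} (hX : Measurable X) {g : Ω → ℝ} (hg : Measurable g) {C : ℝ}
    (hgb : ∀ ω, |g ω| ≤ C)
    (h : ∀ (l : ℝ) (A : Set Ω), MeasurableSet[F] A →
      ∫ ω in A, Complex.exp (l * X ω * Complex.I) * (g ω : ℂ) ∂μ = 0)
    {A : Set Ω} (hA : MeasurableSet[F ⊔ MeasurableSpace.comap X inferInstance] A) :
    ∫ ω in A, g ω ∂μ = 0 := by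
  have hgi : Integrable g μ := Integrable.of_bound hg.aestronglyMeasurable C (ae_of_all _ hgb)
  have hle : F ⊔ MeasurableSpace.comap X inferInstance ≤ mΩ := sup_le hF hX.comap_le
  have hrect : ∀ A B, MeasurableSet[F] A → MeasurableSet B → ∫ ω in A ∩ X ⁻¹' B, g ω ∂μ = 0 := by
    intro A B hA hB
    have := setIntegral_preimage_eq_zero (μ := μ.restrict A) hX hg hgb (fun l => h l A hA) hB
    rwa [Measure.restrict_restrict (hX hB), Set.inter_comm] at this
  have huniv : ∫ ω, g ω ∂μ = 0 := by
    simpa using hrect Set.univ Set.univ .univ .univ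
  induction A, hA using MeasurableSpace.induction_on_inter
    (generateFrom_inter_preimage F X) (isPiSystem_inter_preimage F X) with
  | empty => simp
  | basic t ht =>
    obtain ⟨A, B, hA, hB, rfl⟩ := ht
    exact hrect A B hA hB
  | compl t ht ih =>
    have := integral_add_compl (hle _ ht) hgi
    rw [ih, huniv] at this
    simpa using this
  | iUnion f hd hm ih =>
    rw [integral_iUnion (fun i => hle _ (hm i)) hd hgi.integrableOn]
    simp [ih]

/-- A bounded complex function whose product with every character of `X` integrates to zero over the
sets of `F` integrates to zero over the sets of `F ⊔ σ(X)`. -/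
lemma setIntegral_complex_eq_zero_of_sup_comap {F mΩ : MeasurableSpace Ω} (hF : F ≤ mΩ)
    {μ : Measure Ω} [IsFiniteMeasure μ] {X : Ω → ℝ} (hX : Measurable X) {g : Ω → ℂ}
    (hg : Measurable g) {C : ℝ} (hgb : ∀ ω, ‖g ω‖ ≤ C)
    (h : ∀ (l : ℝ) (A : Set Ω), MeasurableSet[F] A →
      ∫ ω in A, Complex.exp (l * X ω * Complex.I) * g ω ∂μ = 0)
    {A : Set Ω} (hA : MeasurableSet[F ⊔ MeasurableSpace.comap X inferInstance] A) :
    ∫ ω in A, g ω ∂μ = 0 := by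
  have hgi : Integrable g μ := Integrable.of_bound hg.aestronglyMeasurable C (ae_of_all _ hgb)
  have hint : ∀ (l : ℝ), Integrable (fun ω => Complex.exp (l * X ω * Complex.I) * g ω) μ := by
    intro l
    refine hgi.norm.mono' (by fun_prop) (ae_of_all _ fun ω => ?_)
    have := norm_cexp_real_mul_I (l * X ω)
    push_cast at this
    rw [norm_mul]
    exact mul_le_of_le_one_left (norm_nonneg _) this
  -- Conjugation exchanges `l` and `-l`, so the hypothesis passes to the conjugate of `g`, hence to
  -- its real and imaginary parts.
  have hconj : ∀ (l : ℝ) (A : Set Ω), MeasurableSet[F] A →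
      ∫ ω in A, Complex.exp (l * X ω * Complex.I) * (starRingEnd ℂ) (g ω) ∂μ = 0 := by
    intro l A hA
    have := congrArg (starRingEnd ℂ) (h (-l) A hA)
    rw [← integral_conj, map_zero] at this
    rw [← this]
    congr with ω
    rw [map_mul, ← Complex.exp_conj]
    simp
  have hint' : ∀ (l : ℝ),
      Integrable (fun ω => Complex.exp (l * X ω * Complex.I) * (starRingEnd ℂ) (g ω)) μ := by
    intro l
    refine (hint l).mono ?_ (ae_of_all _ fun ω => by simp)
    have : Measurable fun ω => (starRingEnd ℂ) (g ω) := Complex.continuous_conj.measurable.comp hg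
    fun_prop
  have hre : ∫ ω in A, (g ω).re ∂μ = 0 := by
    refine setIntegral_eq_zero_of_sup_comap hF hX (by fun_prop)
      (fun ω => (Complex.abs_re_le_norm _).trans (hgb ω)) (fun l A hA => ?_) hA
    have : ∀ ω, Complex.exp (l * X ω * Complex.I) * ((g ω).re : ℂ) =
        (1 / 2) * (Complex.exp (l * X ω * Complex.I) * g ω +
          Complex.exp (l * X ω * Complex.I) * (starRingEnd ℂ) (g ω)) := by
      intro ω
      rw [← mul_add, Complex.add_conj]
      push_cast
      ring
    simp only [this]
    rw [integral_const_mul, integral_add (hint l).integrableOn (hint' l).integrableOn, h l A hA,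
      hconj l A hA]
    simp
  have him : ∫ ω in A, (g ω).im ∂μ = 0 := by
    refine setIntegral_eq_zero_of_sup_comap hF hX (by fun_prop)
      (fun ω => (Complex.abs_im_le_norm _).trans (hgb ω)) (fun l A hA => ?_) hA
    have : ∀ ω, Complex.exp (l * X ω * Complex.I) * ((g ω).im : ℂ) =
        (-Complex.I / 2) * (Complex.exp (l * X ω * Complex.I) * g ω -
          Complex.exp (l * X ω * Complex.I) * (starRingEnd ℂ) (g ω)) := by
      intro ω
      rw [← mul_sub, Complex.sub_conj]
      push_cast
      linear_combination (Complex.exp (l * X ω * Complex.I) * (g ω).im) * Complex.I_sq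
    simp only [this]
    rw [integral_const_mul, integral_sub (hint l).integrableOn (hint' l).integrableOn, h l A hA,
      hconj l A hA]
    simp
  have h3 := integral_re_add_im (𝕜 := ℂ) (hgi.integrableOn (s := A))
  rw [← h3]
  simp only [RCLike.re_eq_complex_re, RCLike.im_eq_complex_im, hre, him]
  simp

end Update

/-! ### Independence of joined σ-algebras -/

section Independence

/-- If `m₂` is independent of `m₃`, and `m₁` of both together, then `m₁` and `m₂` together are
independent of `m₃`. -/
lemma indep_sup_left_of_indep_sup_right {Ω : Type*} {m₁ m₂ m₃ mΩ : MeasurableSpace Ω}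
    {μ : Measure Ω} [IsProbabilityMeasure μ] (h₁ : m₁ ≤ mΩ) (h₂ : m₂ ≤ mΩ) (h₃ : m₃ ≤ mΩ)
    (h : Indep m₁ (m₂ ⊔ m₃) μ) (h' : Indep m₂ m₃ μ) : Indep (m₁ ⊔ m₂) m₃ μ := by
  refine IndepSets.indep (sup_le h₁ h₂) h₃
    (p1 := {s | ∃ A B, MeasurableSet[m₁] A ∧ MeasurableSet[m₂] B ∧ s = A ∩ B})
    (p2 := {s | MeasurableSet[m₃] s}) ?_ ?_ ?_ ?_ ?_
  -- With `id` as the map and `m₂` as the target σ-algebra, the earlier sets `A ∩ X ⁻¹' B` become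
  -- the intersections `A ∩ B`.
  · simpa using @isPiSystem_inter_preimage Ω Ω m₂ m₁ id
  · exact @MeasurableSpace.isPiSystem_measurableSet Ω m₃
  · simpa using @generateFrom_inter_preimage Ω Ω m₂ m₁ id
  · exact (@MeasurableSpace.generateFrom_measurableSet Ω m₃).symm
  · rw [IndepSets_iff]
    rintro _ C ⟨A, B, hA, hB, rfl⟩ hC
    have hB' := le_sup_left (a := m₂) (b := m₃) _ hB
    have hC' := le_sup_right (a := m₂) (b := m₃) _ hC
    rw [Indep_iff] at h h'
    rw [Set.inter_assoc, h A _ hA (hB'.inter hC'), h' B C hB hC, h A B hA hB', mul_assoc]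

end Independence

/-! ### Measurability -/

section Measurability

variable {d : ℕ} {Ω : Type*} {m : MeasurableSpace Ω}

lemma measurable_matrix_mul {M N : Ω → Matrix (Fin d) (Fin d) ℝ}
    (hM : ∀ i j, Measurable fun ω => M ω i j) (hN : ∀ i j, Measurable fun ω => N ω i j)
    (i j : Fin d) : Measurable fun ω => (M ω * N ω) i j := by
  simp only [Matrix.mul_apply]
  exact Finset.measurable_sum _ fun k _ => (hM i k).mul (hN k j)

lemma measurable_quadForm {M : Ω → Matrix (Fin d) (Fin d) ℝ}
    (hM : ∀ i j, Measurable fun ω => M ω i j) {v : Ω → EuclVec d} (hv : Measurable v) :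
    Measurable fun ω => quadForm (M ω) (v ω) := by
  simp only [quadForm_eq_sum]
  have := hM
  exact Finset.measurable_sum _ fun i _ => Finset.measurable_sum _ fun j _ => by fun_prop

lemma measurable_toEuclideanCLM_apply {M : Ω → Matrix (Fin d) (Fin d) ℝ}
    (hM : ∀ i j, Measurable fun ω => M ω i j) {v : Ω → EuclVec d} (hv : Measurable v) :
    Measurable fun ω => Matrix.toEuclideanCLM (𝕜 := ℝ) (M ω) (v ω) := by
  refine (WithLp.measurable_toLp 2 (Fin d → ℝ)).comp
    (f := fun ω => (M ω).mulVec (v ω).ofLp) (measurable_pi_lambda _ fun i => ?_)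
  simp only [Matrix.mulVec, dotProduct]
  have := hM
  exact Finset.measurable_sum _ fun j _ => by fun_prop

lemma measurable_riccatiStep (Γ Q : Matrix (Fin d) (Fin d) ℝ) (σ : ℝ)
    {P : Ω → Matrix (Fin d) (Fin d) ℝ} (hP : ∀ i j, Measurable fun ω => P ω i j)
    {a : Ω → EuclVec d} (ha : Measurable a) (i j : Fin d) :
    Measurable fun ω => riccatiStep Γ Q σ (P ω) (a ω) i j := by
  have hq := measurable_quadForm hP ha
  have hc : ∀ (M : Matrix (Fin d) (Fin d) ℝ) i j, Measurable fun _ : Ω => M i j :=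
    fun M i j => measurable_const
  have hv : ∀ i j, Measurable fun ω => Matrix.vecMulVec (a ω).ofLp (a ω).ofLp i j := by
    intro i j
    simp only [Matrix.vecMulVec_apply]
    fun_prop
  have h1 : ∀ i j, Measurable fun ω => (Γ * P ω * Γ.transpose) i j :=
    measurable_matrix_mul (measurable_matrix_mul (hc Γ) hP) (hc Γ.transpose)
  have h2 : ∀ i j, Measurable fun ω => (Γ * P ω * Matrix.vecMulVec (a ω).ofLp (a ω).ofLp) i j :=
    measurable_matrix_mul (measurable_matrix_mul (hc Γ) hP) hv
  have h3 : ∀ i j, Measurable fun ω =>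
      (Γ * P ω * Matrix.vecMulVec (a ω).ofLp (a ω).ofLp * P ω * Γ.transpose) i j :=
    measurable_matrix_mul (measurable_matrix_mul h2 hP) (hc Γ.transpose)
  simp only [riccatiStep, Matrix.sub_apply, Matrix.add_apply, Matrix.smul_apply, smul_eq_mul]
  exact ((h1 i j).add_const _).sub ((hq.add_const _).inv.mul (h3 i j))

end Measurability

/-! ### The Kalman filter -/

section Kalman

variable {d : ℕ}

/-- The conditional mean `E[z_t | X_0, …, X_{t-1}]` computed by the Kalman filter along the actions
`a` and the rewards `X`. -/
noncomputable def kalmanMean (Γ Q S₀ : Matrix (Fin d) (Fin d) ℝ) (σ : ℝ) (a : ℕ → EuclVec d)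
    (X : ℕ → ℝ) : ℕ → EuclVec d
  | 0 => 0
  | t + 1 =>
    Matrix.toEuclideanCLM (𝕜 := ℝ) Γ (kalmanMean Γ Q S₀ σ a X t) +
      ((quadForm (kalmanCov Γ Q S₀ σ a t) (a t) + σ ^ 2)⁻¹ *
        (X t - inner ℝ (a t) (kalmanMean Γ Q S₀ σ a X t))) •
      Matrix.toEuclideanCLM (𝕜 := ℝ) Γ
        (Matrix.toEuclideanCLM (𝕜 := ℝ) (kalmanCov Γ Q S₀ σ a t) (a t))

/-- The characteristic function of `N(m, P)`. -/
noncomputable def gaussianCharFun (m : EuclVec d) (P : Matrix (Fin d) (Fin d) ℝ) (u : EuclVec d) :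
    ℂ :=
  Complex.exp (inner ℝ u m * Complex.I - quadForm P u / 2)

lemma norm_gaussianCharFun (m : EuclVec d) (P : Matrix (Fin d) (Fin d) ℝ) (u : EuclVec d) :
    ‖gaussianCharFun m P u‖ = Real.exp (-quadForm P u / 2) := by
  rw [gaussianCharFun, Complex.norm_exp]
  congr 1
  simp [← Complex.ofReal_ofNat, -Complex.ofReal_div]
  ring

lemma norm_gaussianCharFun_le_one (m : EuclVec d) {P : Matrix (Fin d) (Fin d) ℝ}
    (hP : P.PosSemidef) (u : EuclVec d) : ‖gaussianCharFun m P u‖ ≤ 1 := by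
  rw [norm_gaussianCharFun, Real.exp_le_one_iff]
  linarith [hP.quadForm_nonneg u]

lemma continuous_gaussianCharFun (m : EuclVec d) (P : Matrix (Fin d) (Fin d) ℝ) :
    Continuous (gaussianCharFun m P) := by
  unfold gaussianCharFun
  fun_prop

lemma measurable_gaussianCharFun {Ω : Type*} {_ : MeasurableSpace Ω} {m u : Ω → EuclVec d}
    (hm : Measurable m) {P : Ω → Matrix (Fin d) (Fin d) ℝ}
    (hP : ∀ i j, Measurable fun ω => P ω i j) (hu : Measurable u) :
    Measurable fun ω => gaussianCharFun (m ω) (P ω) (u ω) := by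
  have := measurable_quadForm hP hu
  unfold gaussianCharFun
  fun_prop

lemma charFun_multivariateGaussian_eq {S : Matrix (Fin d) (Fin d) ℝ} (hS : S.PosSemidef)
    (m u : EuclVec d) : charFun (multivariateGaussian m S) u = gaussianCharFun m S u := by
  rw [charFun_multivariateGaussian hS, gaussianCharFun, quadForm]

end Kalman

/-! ### Adaptedness of the filter -/

namespace IsLGDSBandit

variable {d : ℕ} {Ω S : Type*} [MeasurableSpace Ω] [MeasurableSpace S]
  {μ : Measure Ω} {Γ Q S₀ : Matrix (Fin d) (Fin d) ℝ} {σ : ℝ} {U : Ω → S}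
  {z ξ : ℕ → Ω → EuclVec d} {η : ℕ → Ω → ℝ} {a : ℕ → Ω → EuclVec d} {X : ℕ → Ω → ℝ}

lemma state_step' (hB : IsLGDSBandit μ Γ Q S₀ σ U z ξ η a X) (t : ℕ) :
    z (t + 1) = fun ω => Matrix.toEuclideanCLM (𝕜 := ℝ) Γ (z t ω) + ξ t ω :=
  funext fun ω => hB.state_step t ω

lemma measurable_state (hB : IsLGDSBandit μ Γ Q S₀ σ U z ξ η a X) (t : ℕ) : Measurable (z t) := by
  induction t with
  | zero => exact hB.measurable_z₀
  | succ t ih =>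
    rw [hB.state_step']
    have := hB.measurable_ξ t
    fun_prop

lemma _root_.history_succ {Ω S : Type*} [MeasurableSpace S] (U : Ω → S) (X : ℕ → Ω → ℝ) (t : ℕ) :
    history U X (t + 1) = history U X t ⊔ MeasurableSpace.comap (X t) inferInstance := by
  simp only [history, Finset.range_add_one, Finset.mem_insert, iSup_or, iSup_sup_eq,
    iSup_iSup_eq_left]
  rw [sup_assoc, sup_comm (MeasurableSpace.comap (X t) _)]

lemma history_le (hB : IsLGDSBandit μ Γ Q S₀ σ U z ξ η a X) (t : ℕ) :
    history U X t ≤ ‹MeasurableSpace Ω› := by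
  induction t with
  | zero => simpa [history] using hB.measurable_U.comap_le
  | succ t ih =>
    rw [history_succ]
    refine sup_le ih (Measurable.comap_le ?_)
    rw [funext (hB.reward_eq t)]
    have h1 := (hB.action_adapted t).mono ih le_rfl
    have h2 := hB.measurable_state t
    have h3 := hB.measurable_η t
    fun_prop

lemma measurable_action (hB : IsLGDSBandit μ Γ Q S₀ σ U z ξ η a X) (t : ℕ) : Measurable (a t) :=
  (hB.action_adapted t).mono (hB.history_le t) le_rfl

lemma measurable_reward (hB : IsLGDSBandit μ Γ Q S₀ σ U z ξ η a X) (t : ℕ) : Measurable (X t) := by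
  rw [funext (hB.reward_eq t)]
  have h1 := hB.measurable_action t
  have h2 := hB.measurable_state t
  have h3 := hB.measurable_η t
  fun_prop

lemma _root_.history_le_succ {Ω S : Type*} [MeasurableSpace S] (U : Ω → S) (X : ℕ → Ω → ℝ) (t : ℕ) :
    history U X t ≤ history U X (t + 1) := by
  rw [history_succ]
  exact le_sup_left

/-- The covariance is predictable: `P_{t+1|t}` involves the actions up to `a_t` but not `X_t`, so
the history before round `t` determines it. The two statements are carried together because the
second at `t` gives the first at `t + 1`. -/
lemma measurable_kalmanCov_succ_aux (hB : IsLGDSBandit μ Γ Q S₀ σ U z ξ η a X) (t : ℕ) :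
    (∀ i j, Measurable[history U X t] fun ω => kalmanCov Γ Q S₀ σ (fun s => a s ω) t i j) ∧
    ∀ i j, Measurable[history U X t] fun ω => kalmanCov Γ Q S₀ σ (fun s => a s ω) (t + 1) i j := by
  induction t with
  | zero =>
    have h0 : ∀ i j, Measurable[history U X 0]
        fun ω => kalmanCov Γ Q S₀ σ (fun s => a s ω) 0 i j := fun i j => measurable_const
    exact ⟨h0, measurable_riccatiStep Γ Q σ h0 (hB.action_adapted 0)⟩
  | succ t ih =>
    have h := fun i j => (ih.2 i j).mono (history_le_succ U X t) le_rfl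
    exact ⟨h, measurable_riccatiStep Γ Q σ h (hB.action_adapted (t + 1))⟩

lemma measurable_kalmanCov (hB : IsLGDSBandit μ Γ Q S₀ σ U z ξ η a X) (t : ℕ) (i j : Fin d) :
    Measurable[history U X t] fun ω => kalmanCov Γ Q S₀ σ (fun s => a s ω) t i j :=
  (hB.measurable_kalmanCov_succ_aux t).1 i j

lemma measurable_kalmanCov_succ (hB : IsLGDSBandit μ Γ Q S₀ σ U z ξ η a X) (t : ℕ) (i j : Fin d) :
    Measurable[history U X t] fun ω => kalmanCov Γ Q S₀ σ (fun s => a s ω) (t + 1) i j :=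
  (hB.measurable_kalmanCov_succ_aux t).2 i j

lemma measurable_kalmanMean (hB : IsLGDSBandit μ Γ Q S₀ σ U z ξ η a X) (t : ℕ) :
    Measurable[history U X t]
      fun ω => kalmanMean Γ Q S₀ σ (fun s => a s ω) (fun s => X s ω) t := by
  induction t with
  | zero => exact measurable_const
  | succ t ih =>
    have hle := history_le_succ U X t
    have h1 := ih.mono hle le_rfl
    have h2 := (hB.action_adapted t).mono hle le_rfl
    have h3 := fun i j => (hB.measurable_kalmanCov t i j).mono hle le_rfl
    have h4 : Measurable[history U X (t + 1)] (X t) := by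
      rw [history_succ]
      exact (comap_measurable (X t)).mono le_sup_right le_rfl
    have h5 := measurable_quadForm h3 h2
    have h6 := measurable_toEuclideanCLM_apply h3 h2
    simp only [kalmanMean]
    fun_prop

lemma posSemidef_kalmanCov (hB : IsLGDSBandit μ Γ Q S₀ σ U z ξ η a X) (t : ℕ) (ω : Ω) :
    (kalmanCov Γ Q S₀ σ (fun s => a s ω) t).PosSemidef :=
  _root_.posSemidef_kalmanCov hB.posSemidef_S₀ hB.posSemidef_Q hB.sigma_pos _ t

end IsLGDSBandit

/-! ### Independence of the noise from the past -/

section Independence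

variable {d : ℕ} {Ω S : Type*} [MeasurableSpace S]

/-- The σ-algebra of the seed, the initial state and the noises of the rounds before `t`. -/
abbrev pastNoise (U : Ω → S) (z₀ : Ω → EuclVec d) (ξ : ℕ → Ω → EuclVec d) (η : ℕ → Ω → ℝ) (t : ℕ) :
    MeasurableSpace Ω :=
  MeasurableSpace.comap U inferInstance ⊔ (MeasurableSpace.comap z₀ inferInstance ⊔
    ((⨆ s ∈ Set.Iio t, MeasurableSpace.comap (ξ s) inferInstance) ⊔
      ⨆ s ∈ Set.Iio t, MeasurableSpace.comap (η s) inferInstance))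

lemma pastNoise_mono (U : Ω → S) (z₀ : Ω → EuclVec d) (ξ : ℕ → Ω → EuclVec d) (η : ℕ → Ω → ℝ) :
    Monotone (pastNoise U z₀ ξ η) := fun _ _ h =>
  sup_le_sup le_rfl (sup_le_sup le_rfl (sup_le_sup
    (biSup_mono fun _ hs => lt_of_lt_of_le hs h) (biSup_mono fun _ hs => lt_of_lt_of_le hs h)))

lemma comap_noise_le_pastNoise (U : Ω → S) (z₀ : Ω → EuclVec d) (ξ : ℕ → Ω → EuclVec d)
    (η : ℕ → Ω → ℝ) (t : ℕ) :
    MeasurableSpace.comap (ξ t) inferInstance ≤ pastNoise U z₀ ξ η (t + 1) ∧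
      MeasurableSpace.comap (η t) inferInstance ≤ pastNoise U z₀ ξ η (t + 1) := by
  constructor
  · exact (le_biSup (fun s => MeasurableSpace.comap (ξ s) inferInstance)
      (show t ∈ Set.Iio (t + 1) by simp)).trans
        (le_sup_of_le_right (le_sup_of_le_right le_sup_left))
  · exact (le_biSup (fun s => MeasurableSpace.comap (η s) inferInstance)
      (show t ∈ Set.Iio (t + 1) by simp)).trans
        (le_sup_of_le_right (le_sup_of_le_right le_sup_right))

end Independence

namespace IsLGDSBandit

variable {d : ℕ} {Ω S : Type*} [MeasurableSpace Ω] [MeasurableSpace S]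
  {μ : Measure Ω} {Γ Q S₀ : Matrix (Fin d) (Fin d) ℝ} {σ : ℝ} {U : Ω → S}
  {z ξ : ℕ → Ω → EuclVec d} {η : ℕ → Ω → ℝ} {a : ℕ → Ω → EuclVec d} {X : ℕ → Ω → ℝ}

/-- Actions, rewards and states are built recursively from seed, initial state and earlier noises.
Whatever the policy, the noises of round `t` are therefore independent of the history and of `z_t`.
-/
lemma history_sup_state_le_pastNoise (hB : IsLGDSBandit μ Γ Q S₀ σ U z ξ η a X) (t : ℕ) :
    history U X t ⊔ MeasurableSpace.comap (z t) inferInstance ≤ pastNoise U (z 0) ξ η t := by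
  induction t with
  | zero =>
    refine sup_le ?_ (le_sup_of_le_right le_sup_left)
    rw [show history U X 0 = MeasurableSpace.comap U inferInstance by simp [history]]
    exact le_sup_left
  | succ t ih =>
    have h0 := ih.trans (pastNoise_mono U (z 0) ξ η t.le_succ)
    obtain ⟨h1, h2⟩ := comap_noise_le_pastNoise U (z 0) ξ η t
    have hz : Measurable[pastNoise U (z 0) ξ η (t + 1)] (z t) :=
      (comap_measurable (z t)).mono (le_sup_right.trans h0) le_rfl
    have hξ : Measurable[pastNoise U (z 0) ξ η (t + 1)] (ξ t) :=
      (comap_measurable (ξ t)).mono h1 le_rfl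
    have hη : Measurable[pastNoise U (z 0) ξ η (t + 1)] (η t) :=
      (comap_measurable (η t)).mono h2 le_rfl
    have ha : Measurable[pastNoise U (z 0) ξ η (t + 1)] (a t) :=
      (hB.action_adapted t).mono (le_sup_left.trans h0) le_rfl
    rw [history_succ]
    refine sup_le (sup_le (le_sup_left.trans h0) ?_) ?_
    · rw [funext (hB.reward_eq t)]
      exact Measurable.comap_le (by fun_prop)
    · rw [hB.state_step']
      exact Measurable.comap_le (by fun_prop)

lemma pastNoise_le (hB : IsLGDSBandit μ Γ Q S₀ σ U z ξ η a X) (t : ℕ) :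
    pastNoise U (z 0) ξ η t ≤ ‹MeasurableSpace Ω› :=
  sup_le hB.measurable_U.comap_le (sup_le hB.measurable_z₀.comap_le
    (sup_le (iSup₂_le fun s _ => (hB.measurable_ξ s).comap_le)
      (iSup₂_le fun s _ => (hB.measurable_η s).comap_le)))

/-- The noises of round `t` are independent of the past. -/
lemma indep_pastNoise [IsProbabilityMeasure μ] (hB : IsLGDSBandit μ Γ Q S₀ σ U z ξ η a X) (t : ℕ) :
    Indep (pastNoise U (z 0) ξ η t) (MeasurableSpace.comap (ξ t) inferInstance ⊔
      MeasurableSpace.comap (η t) inferInstance) μ := by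
  have hU := hB.measurable_U.comap_le
  have hz := hB.measurable_z₀.comap_le
  have hξ := fun s => (hB.measurable_ξ s).comap_le
  have hη := fun s => (hB.measurable_η s).comap_le
  have hξs : ⨆ s ∈ Set.Iio t, MeasurableSpace.comap (ξ s) inferInstance ≤ ‹MeasurableSpace Ω› :=
    iSup₂_le fun s _ => hξ s
  have hηs : ⨆ s ∈ Set.Iio t, MeasurableSpace.comap (η s) inferInstance ≤ ‹MeasurableSpace Ω› :=
    iSup₂_le fun s _ => hη s
  have hn : MeasurableSpace.comap (ξ t) inferInstance ⊔
      MeasurableSpace.comap (η t) inferInstance ≤ ‹MeasurableSpace Ω› := sup_le (hξ t) (hη t)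
  have aξ : ∀ s, MeasurableSpace.comap (ξ s) inferInstance ≤
      MeasurableSpace.comap (fun ω t => ξ t ω) inferInstance := fun s =>
    ((measurable_pi_apply s).comp (comap_measurable fun ω t => ξ t ω)).comap_le
  have aη : ∀ s, MeasurableSpace.comap (η s) inferInstance ≤
      MeasurableSpace.comap (fun ω t => η t ω) inferInstance := fun s =>
    ((measurable_pi_apply s).comp (comap_measurable fun ω t => η t ω)).comap_le
  have hb := comap_measurable (m := Prod.instMeasurableSpace)
    (fun ω => ((fun t => ξ t ω), (fun t => η t ω)) : Ω → (ℕ → EuclVec d) × (ℕ → ℝ))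
  have bξ : ∀ s, MeasurableSpace.comap (ξ s) inferInstance ≤ MeasurableSpace.comap
      (fun ω => ((fun t => ξ t ω), (fun t => η t ω)) : Ω → (ℕ → EuclVec d) × (ℕ → ℝ))
      inferInstance := fun s =>
    ((measurable_pi_apply s).comp hb.fst).comap_le
  have bη : ∀ s, MeasurableSpace.comap (η s) inferInstance ≤ MeasurableSpace.comap
      (fun ω => ((fun t => ξ t ω), (fun t => η t ω)) : Ω → (ℕ → EuclVec d) × (ℕ → ℝ))
      inferInstance := fun s =>
    ((measurable_pi_apply s).comp hb.snd).comap_le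
  have hc := comap_measurable (m := Prod.instMeasurableSpace)
    (fun ω => (z 0 ω, (fun t => ξ t ω), (fun t => η t ω)) :
    Ω → EuclVec d × (ℕ → EuclVec d) × (ℕ → ℝ))
  have cz : MeasurableSpace.comap (z 0) inferInstance ≤ MeasurableSpace.comap
      (fun ω => (z 0 ω, (fun t => ξ t ω), (fun t => η t ω)) :
        Ω → EuclVec d × (ℕ → EuclVec d) × (ℕ → ℝ)) inferInstance :=
    hc.fst.comap_le
  have cξ : ∀ s, MeasurableSpace.comap (ξ s) inferInstance ≤ MeasurableSpace.comap
      (fun ω => (z 0 ω, (fun t => ξ t ω), (fun t => η t ω)) :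
        Ω → EuclVec d × (ℕ → EuclVec d) × (ℕ → ℝ)) inferInstance := fun s =>
    ((measurable_pi_apply s).comp hc.snd.fst).comap_le
  have cη : ∀ s, MeasurableSpace.comap (η s) inferInstance ≤ MeasurableSpace.comap
      (fun ω => (z 0 ω, (fun t => ξ t ω), (fun t => η t ω)) :
        Ω → EuclVec d × (ℕ → EuclVec d) × (ℕ → ℝ)) inferInstance := fun s =>
    ((measurable_pi_apply s).comp hc.snd.snd).comap_le
  have i1 := (IndepFun_iff_Indep _ _ _).1 hB.indep_seed
  have i2 := (IndepFun_iff_Indep _ _ _).1 hB.indep_init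
  have i3 := (IndepFun_iff_Indep _ _ _).1 hB.indep_noises
  have hdisj : Disjoint (Set.Iio t) {t} := by simp
  have iξ : Indep (⨆ s ∈ Set.Iio t, MeasurableSpace.comap (ξ s) inferInstance)
      (MeasurableSpace.comap (ξ t) inferInstance) μ := by
    simpa using indep_iSup_of_disjoint hξ ((iIndepFun_iff_iIndep _ _ _).1 hB.iIndep_ξ) hdisj
  have iη : Indep (⨆ s ∈ Set.Iio t, MeasurableSpace.comap (η s) inferInstance)
      (MeasurableSpace.comap (η t) inferInstance) μ := by
    simpa using indep_iSup_of_disjoint hη ((iIndepFun_iff_iIndep _ _ _).1 hB.iIndep_η) hdisj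
  -- The past is peeled off one generator at a time: the seed, the initial state, the earlier `ξ`,
  -- and the earlier `η`.
  refine indep_sup_left_of_indep_sup_right hU (sup_le hz (sup_le hξs hηs)) hn
    (indep_of_indep_of_le_right i1 (sup_le (sup_le cz (sup_le (iSup₂_le fun s _ => cξ s)
      (iSup₂_le fun s _ => cη s))) (sup_le (cξ t) (cη t)))) ?_
  refine indep_sup_left_of_indep_sup_right hz (sup_le hξs hηs) hn
    (indep_of_indep_of_le_right i2 (sup_le (sup_le (iSup₂_le fun s _ => bξ s)
      (iSup₂_le fun s _ => bη s)) (sup_le (bξ t) (bη t)))) ?_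
  have hηall : (⨆ s ∈ Set.Iio t, MeasurableSpace.comap (η s) inferInstance) ⊔
      MeasurableSpace.comap (η t) inferInstance ≤
        MeasurableSpace.comap (fun ω t => η t ω) inferInstance :=
    sup_le (iSup₂_le fun s _ => aη s) (aη t)
  have j1 : Indep (⨆ s ∈ Set.Iio t, MeasurableSpace.comap (ξ s) inferInstance)
      (MeasurableSpace.comap (ξ t) inferInstance ⊔
        ((⨆ s ∈ Set.Iio t, MeasurableSpace.comap (η s) inferInstance) ⊔
          MeasurableSpace.comap (η t) inferInstance)) μ := by
    rw [sup_comm]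
    refine (indep_sup_left_of_indep_sup_right (sup_le hηs (hη t)) (hξ t) hξs ?_ iξ.symm).symm
    exact indep_of_indep_of_le_left (indep_of_indep_of_le_right i3.symm
      (sup_le (aξ t) (iSup₂_le fun s _ => aξ s))) hηall
  have j2 : Indep (⨆ s ∈ Set.Iio t, MeasurableSpace.comap (η s) inferInstance)
      (MeasurableSpace.comap (ξ t) inferInstance ⊔
          MeasurableSpace.comap (η t) inferInstance) μ := by
    refine (indep_sup_left_of_indep_sup_right (hξ t) (hη t) hηs ?_ iη.symm).symm
    exact indep_of_indep_of_le_left (indep_of_indep_of_le_right i3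
      ((sup_comm _ _).le.trans hηall)) (aξ t)
  refine indep_sup_left_of_indep_sup_right hξs hηs hn ?_ j2
  rwa [sup_left_comm]

lemma indep_ξ_η (hB : IsLGDSBandit μ Γ Q S₀ σ U z ξ η a X) (t : ℕ) :
    Indep (MeasurableSpace.comap (η t) inferInstance)
      (MeasurableSpace.comap (ξ t) inferInstance) μ := by
  refine indep_of_indep_of_le_left (indep_of_indep_of_le_right
    ((IndepFun_iff_Indep _ _ _).1 hB.indep_noises).symm ?_) ?_
  · exact ((measurable_pi_apply t).comp (comap_measurable fun ω t => ξ t ω)).comap_le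
  · exact ((measurable_pi_apply t).comp (comap_measurable fun ω t => η t ω)).comap_le

lemma hasCondCharFun_η [IsProbabilityMeasure μ] (hB : IsLGDSBandit μ Γ Q S₀ σ U z ξ η a X)
    (t : ℕ) :
    HasCondCharFun (history U X t ⊔ MeasurableSpace.comap (z t) inferInstance) μ (η t)
      (fun l _ => Complex.exp (-(σ ^ 2 * l ^ 2 / 2 : ℝ))) := by
  have hle := hB.history_sup_state_le_pastNoise t
  have h := hasCondCharFun_of_indep (hle.trans (hB.pastNoise_le t)) (hB.measurable_η t)
    (indep_of_indep_of_le_left (indep_of_indep_of_le_right (hB.indep_pastNoise t) le_sup_right) hle)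
  convert h using 3 with l _
  rw [(hB.law_η t).map_eq, charFun_gaussianReal]
  simp [Real.coe_toNNReal _ (sq_nonneg σ)]

/-- Conditioning also on `η t` allows the noises to be integrated out in turn: first `ξ t`, then `η
t`, leaving a function of the history and `z t`. -/
lemma hasCondCharFun_ξ [IsProbabilityMeasure μ] (hB : IsLGDSBandit μ Γ Q S₀ σ U z ξ η a X)
    (t : ℕ) :
    HasCondCharFun (history U X t ⊔ MeasurableSpace.comap (z t) inferInstance ⊔
      MeasurableSpace.comap (η t) inferInstance) μ (ξ t) (fun u _ => gaussianCharFun 0 Q u) := by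
  have hle := hB.history_sup_state_le_pastNoise t
  have h := hasCondCharFun_of_indep
    (sup_le (hle.trans (hB.pastNoise_le t)) (hB.measurable_η t).comap_le) (hB.measurable_ξ t)
    (indep_sup_left_of_indep_sup_right (hle.trans (hB.pastNoise_le t)) (hB.measurable_η t).comap_le
      (hB.measurable_ξ t).comap_le (by
        rw [sup_comm (MeasurableSpace.comap (η t) _)]
        exact indep_of_indep_of_le_left (hB.indep_pastNoise t) hle) (hB.indep_ξ_η t))
  convert h using 3 with l _
  rw [(hB.law_ξ t).map_eq, charFun_multivariateGaussian_eq hB.posSemidef_Q]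

end IsLGDSBandit

/-! ### The Kalman filter computes the conditional law of the state -/

lemma integral_indicator_one_mul {Ω : Type*} [MeasurableSpace Ω] {μ : Measure Ω} {A : Set Ω}
    (hA : MeasurableSet A) (f : Ω → ℂ) :
    ∫ ω, A.indicator (fun _ => (1 : ℂ)) ω * f ω ∂μ = ∫ ω in A, f ω ∂μ := by
  rw [← integral_indicator hA]
  congr with ω
  by_cases hω : ω ∈ A <;> simp [hω]

lemma norm_indicator_one_le {Ω : Type*} (A : Set Ω) (ω : Ω) :
    ‖A.indicator (fun _ => (1 : ℂ)) ω‖ ≤ 1 := by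
  by_cases hω : ω ∈ A <;> simp [hω]

/-- The Gaussian update identity behind the Kalman filter: observing `⟨a, z⟩ + η` for
`z ∼ N(m, P)`, and moving on to `Γ z + ξ`. -/
lemma gaussianCharFun_update {d : ℕ} {Γ Q P : Matrix (Fin d) (Fin d) ℝ} (hP : P.PosSemidef)
    {σ : ℝ} (hσ : 0 < σ) (a m u : EuclVec d) (l k : ℝ)
    (hk : k = (quadForm P a + σ ^ 2)⁻¹ * inner ℝ
      (Matrix.toEuclideanCLM (𝕜 := ℝ) Γ.transpose u) (Matrix.toEuclideanCLM (𝕜 := ℝ) P a)) :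
    gaussianCharFun 0 Q u * Complex.exp (-(σ ^ 2 * l ^ 2 / 2 : ℝ)) *
        gaussianCharFun m P (Matrix.toEuclideanCLM (𝕜 := ℝ) Γ.transpose u + l • a) =
      gaussianCharFun (Matrix.toEuclideanCLM (𝕜 := ℝ) Γ m -
        ((quadForm P a + σ ^ 2)⁻¹ * inner ℝ a m) • Matrix.toEuclideanCLM (𝕜 := ℝ) Γ
          (Matrix.toEuclideanCLM (𝕜 := ℝ) P a)) (riccatiStep Γ Q σ P a) u *
        Complex.exp (-(σ ^ 2 * (l + k) ^ 2 / 2 : ℝ)) * gaussianCharFun m P ((l + k) • a) := by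
  have hs : quadForm P a + σ ^ 2 ≠ 0 := by
    have := hP.quadForm_nonneg a
    positivity
  set b := inner ℝ (Matrix.toEuclideanCLM (𝕜 := ℝ) Γ.transpose u)
    (Matrix.toEuclideanCLM (𝕜 := ℝ) P a) with hb
  set x := inner ℝ (Matrix.toEuclideanCLM (𝕜 := ℝ) Γ.transpose u) m with hx
  -- Completing the square in `l`: `k` is the shift that absorbs the cross term `2 * l * b`, and the
  -- leftover `b ^ 2 / (aᵀ P a + σ ^ 2)` is the Riccati correction.
  have e1 : quadForm Q u + σ ^ 2 * l ^ 2 +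
      quadForm P (Matrix.toEuclideanCLM (𝕜 := ℝ) Γ.transpose u + l • a) =
      quadForm (riccatiStep Γ Q σ P a) u + σ ^ 2 * (l + k) ^ 2 + quadForm P ((l + k) • a) := by
    rw [quadForm_riccatiStep hP.isHermitian, quadForm_add_smul hP.isHermitian, quadForm_smul_vec,
      ← hb, hk]
    field_simp
    ring
  have e2 : inner ℝ (Matrix.toEuclideanCLM (𝕜 := ℝ) Γ.transpose u + l • a) m =
      inner ℝ u (Matrix.toEuclideanCLM (𝕜 := ℝ) Γ m -
        ((quadForm P a + σ ^ 2)⁻¹ * inner ℝ a m) • Matrix.toEuclideanCLM (𝕜 := ℝ) Γ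
          (Matrix.toEuclideanCLM (𝕜 := ℝ) P a)) + inner ℝ ((l + k) • a) m := by
    rw [inner_sub_right, real_inner_smul_right, ← inner_toEuclideanCLM_transpose,
      ← inner_toEuclideanCLM_transpose, ← hb, inner_add_left, real_inner_smul_left,
      real_inner_smul_left, hk]
    ring
  have e1' := congrArg (fun r : ℝ => (r : ℂ)) e1
  have e2' := congrArg (fun r : ℝ => (r : ℂ)) e2
  simp only [gaussianCharFun, ← Complex.exp_add, inner_zero_right]
  congr 1
  push_cast at e1' e2' ⊢
  linear_combination (-1 / 2) * e1' + Complex.I * e2'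

namespace IsLGDSBandit

variable {d : ℕ} {Ω S : Type*} [MeasurableSpace Ω] [MeasurableSpace S]
  {μ : Measure Ω} {Γ Q S₀ : Matrix (Fin d) (Fin d) ℝ} {σ : ℝ} {U : Ω → S}
  {z ξ : ℕ → Ω → EuclVec d} {η : ℕ → Ω → ℝ} {a : ℕ → Ω → EuclVec d} {X : ℕ → Ω → ℝ}

/-- The frequency `κ` may be random: the filter's mean contains `X t` with a gain that depends on
the history. -/
lemma integral_mul_cexp_η [IsProbabilityMeasure μ] (hB : IsLGDSBandit μ Γ Q S₀ σ U z ξ η a X)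
    (t : ℕ) {W : Ω → ℂ}
    (hW : Measurable[history U X t ⊔ MeasurableSpace.comap (z t) inferInstance] W)
    (hWb : ∀ ω, ‖W ω‖ ≤ 1) {κ : Ω → ℝ}
    (hκ : Measurable[history U X t ⊔ MeasurableSpace.comap (z t) inferInstance] κ) :
    ∫ ω, W ω * Complex.exp ((κ ω * η t ω : ℝ) * Complex.I) ∂μ =
      ∫ ω, W ω * Complex.exp (-(σ ^ 2 * κ ω ^ 2 / 2 : ℝ)) ∂μ := by
  have h := (hB.hasCondCharFun_η t).integral_mul_eq
    ((hB.history_sup_state_le_pastNoise t).trans (hB.pastNoise_le t)) (hB.measurable_η t)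
    (fun _ => measurable_const) (fun _ => by fun_prop) (fun l _ => ?_) hW hWb hκ
  · simpa [mul_comm] using h
  · rw [← Complex.ofReal_neg, ← Complex.ofReal_exp, Complex.norm_real, Real.norm_eq_abs,
      Real.abs_exp, Real.exp_le_one_iff]
    have : 0 ≤ σ ^ 2 * l ^ 2 / 2 := by positivity
    linarith

lemma integral_mul_cexp_ξ [IsProbabilityMeasure μ] (hB : IsLGDSBandit μ Γ Q S₀ σ U z ξ η a X)
    (t : ℕ) {W : Ω → ℂ}
    (hW : Measurable[history U X t ⊔ MeasurableSpace.comap (z t) inferInstance ⊔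
      MeasurableSpace.comap (η t) inferInstance] W) (hWb : ∀ ω, ‖W ω‖ ≤ 1) (u : EuclVec d) :
    ∫ ω, W ω * Complex.exp (inner ℝ u (ξ t ω) * Complex.I) ∂μ =
      ∫ ω, W ω * gaussianCharFun 0 Q u ∂μ :=
  (hB.hasCondCharFun_ξ t).integral_mul_eq
    (sup_le ((hB.history_sup_state_le_pastNoise t).trans (hB.pastNoise_le t))
      (hB.measurable_η t).comap_le) (hB.measurable_ξ t)
    (fun _ => measurable_const) (fun _ => continuous_gaussianCharFun _ _)
    (fun u _ => norm_gaussianCharFun_le_one 0 hB.posSemidef_Q u) hW hWb measurable_const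

lemma integral_mul_cexp_state [IsProbabilityMeasure μ] (hB : IsLGDSBandit μ Γ Q S₀ σ U z ξ η a X)
    (t : ℕ) (h : HasCondCharFun (history U X t) μ (z t) fun u ω =>
      gaussianCharFun (kalmanMean Γ Q S₀ σ (fun s => a s ω) (fun s => X s ω) t)
        (kalmanCov Γ Q S₀ σ (fun s => a s ω) t) u)
    {W : Ω → ℂ} (hW : Measurable[history U X t] W) (hWb : ∀ ω, ‖W ω‖ ≤ 1) {V : Ω → EuclVec d}
    (hV : Measurable[history U X t] V) :
    ∫ ω, W ω * Complex.exp (inner ℝ (V ω) (z t ω) * Complex.I) ∂μ =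
      ∫ ω, W ω * gaussianCharFun (kalmanMean Γ Q S₀ σ (fun s => a s ω) (fun s => X s ω) t)
        (kalmanCov Γ Q S₀ σ (fun s => a s ω) t) (V ω) ∂μ :=
  h.integral_mul_eq (hB.history_le t) (hB.measurable_state t)
    (fun _ => (measurable_gaussianCharFun (hB.measurable_kalmanMean t)
      (hB.measurable_kalmanCov t) measurable_const).mono (hB.history_le t) le_rfl)
    (fun _ => continuous_gaussianCharFun _ _)
    (fun u ω => norm_gaussianCharFun_le_one _ (hB.posSemidef_kalmanCov t ω) u) hW hWb hV

/-- Conditionally on the history, the state is Gaussian, with the mean and the covariance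
matrix computed by the Kalman filter along the chosen actions. -/
theorem hasCondCharFun_state [IsProbabilityMeasure μ]
    (hB : IsLGDSBandit μ Γ Q S₀ σ U z ξ η a X) (t : ℕ) :
    HasCondCharFun (history U X t) μ (z t) fun u ω =>
      gaussianCharFun (kalmanMean Γ Q S₀ σ (fun s => a s ω) (fun s => X s ω) t)
        (kalmanCov Γ Q S₀ σ (fun s => a s ω) t) u := by
  induction t with
  | zero =>
    have hi : Indep (history U X 0) (MeasurableSpace.comap (z 0) inferInstance) μ := by
      rw [show history U X 0 = MeasurableSpace.comap U inferInstance by simp [history]]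
      exact (IndepFun_iff_Indep _ _ _).1 (hB.indep_seed.comp measurable_id measurable_fst)
    convert hasCondCharFun_of_indep (hB.history_le 0) hB.measurable_z₀ hi using 3 with u ω
    rw [hB.law_z₀.map_eq, charFun_multivariateGaussian_eq hB.posSemidef_S₀]
    rfl
  | succ t ih =>
    intro u A hA
    have hF := hB.history_le t
    rw [history_succ] at hA
    have hle : history U X t ⊔ MeasurableSpace.comap (X t) inferInstance ≤ ‹MeasurableSpace Ω› := by
      rw [← history_succ]
      exact hB.history_le (t + 1)
    have hψm : Measurable fun ω => gaussianCharFun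
        (kalmanMean Γ Q S₀ σ (fun s => a s ω) (fun s => X s ω) (t + 1))
        (kalmanCov Γ Q S₀ σ (fun s => a s ω) (t + 1)) u :=
      (measurable_gaussianCharFun (hB.measurable_kalmanMean (t + 1))
        (hB.measurable_kalmanCov (t + 1)) measurable_const).mono (hB.history_le (t + 1)) le_rfl
    have hψb : ∀ ω, ‖gaussianCharFun
        (kalmanMean Γ Q S₀ σ (fun s => a s ω) (fun s => X s ω) (t + 1))
        (kalmanCov Γ Q S₀ σ (fun s => a s ω) (t + 1)) u‖ ≤ 1 := fun ω =>
      norm_gaussianCharFun_le_one _ (hB.posSemidef_kalmanCov (t + 1) ω) u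
    have hem : Measurable fun ω => Complex.exp (inner ℝ u (z (t + 1) ω) * Complex.I) := by
      have := hB.measurable_state (t + 1)
      fun_prop
    have heb : ∀ ω, ‖Complex.exp (inner ℝ u (z (t + 1) ω) * Complex.I)‖ ≤ 1 := fun ω =>
      norm_cexp_real_mul_I _
    have hint : ∀ {f : Ω → ℂ}, Measurable f → (∀ ω, ‖f ω‖ ≤ 1) → Integrable f μ := fun hf hb =>
      Integrable.of_bound hf.aestronglyMeasurable 1 (ae_of_all _ hb)
    rw [← sub_eq_zero, ← integral_sub (hint hem heb).integrableOn (hint hψm hψb).integrableOn]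
    -- The new history adds `X t` to the old one, so it suffices to test against `exp(i l X_t)` on
    -- events `B` of the old history.
    refine setIntegral_complex_eq_zero_of_sup_comap hF (hB.measurable_reward t) (hem.sub hψm)
      (C := 1 + 1) (fun ω => (norm_sub_le _ _).trans (add_le_add (heb ω) (hψb ω)))
      (fun l B hBm => ?_) hA
    have hXm := hB.measurable_reward t
    have hlb : ∀ ω, ‖Complex.exp (l * X t ω * Complex.I)‖ ≤ 1 := fun ω => by
      simpa using norm_cexp_real_mul_I (l * X t ω)
    have hprod : ∀ {f g : Ω → ℂ}, (∀ ω, ‖f ω‖ ≤ 1) → (∀ ω, ‖g ω‖ ≤ 1) → ∀ ω, ‖f ω * g ω‖ ≤ 1 :=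
      fun hf hg ω => by
        rw [norm_mul]
        exact mul_le_one₀ (hf ω) (norm_nonneg _) (hg ω)
    simp only [Pi.sub_apply, mul_sub]
    rw [integral_sub (hint (by fun_prop) (hprod hlb heb)).integrableOn
      (hint (by fun_prop) (hprod hlb hψb)).integrableOn, sub_eq_zero,
      ← integral_indicator_one_mul (hF _ hBm), ← integral_indicator_one_mul (hF _ hBm)]
    have h1m : Measurable[history U X t] (B.indicator (fun _ => (1 : ℂ))) :=
      measurable_const.indicator hBm
    have ham := hB.action_adapted t
    have hPm := hB.measurable_kalmanCov t
    have hPm' := hB.measurable_kalmanCov_succ t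
    have hmm := hB.measurable_kalmanMean t
    set m : Ω → EuclVec d := fun ω => kalmanMean Γ Q S₀ σ (fun s => a s ω) (fun s => X s ω) t
      with hm
    set P : Ω → Matrix (Fin d) (Fin d) ℝ := fun ω => kalmanCov Γ Q S₀ σ (fun s => a s ω) t
      with hP
    have hqm := measurable_quadForm hPm ham
    have hbm := measurable_toEuclideanCLM_apply hPm ham
    -- `k` is the coefficient of `X t` in `⟨u, m_{t+1}⟩`, and `m'` below is the part of `m_{t+1}`
    -- free of `X t`. Thus `l X_t + ⟨u, m_{t+1}⟩ = ⟨u, m'⟩ + (l + k) X_t`.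
    set k : Ω → ℝ := fun ω => (quadForm (P ω) (a t ω) + σ ^ 2)⁻¹ * inner ℝ
      (Matrix.toEuclideanCLM (𝕜 := ℝ) Γ.transpose u)
      (Matrix.toEuclideanCLM (𝕜 := ℝ) (P ω) (a t ω)) with hk
    have hkm : Measurable[history U X t] k := by fun_prop
    set m' : Ω → EuclVec d := fun ω => Matrix.toEuclideanCLM (𝕜 := ℝ) Γ (m ω) -
        ((quadForm (P ω) (a t ω) + σ ^ 2)⁻¹ * inner ℝ (a t ω) (m ω)) •
          Matrix.toEuclideanCLM (𝕜 := ℝ) Γ (Matrix.toEuclideanCLM (𝕜 := ℝ) (P ω) (a t ω)) with hm'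
    have hmm' : Measurable[history U X t] m' := by fun_prop
    set ψ' : Ω → ℂ := fun ω => gaussianCharFun (m' ω) (riccatiStep Γ Q σ (P ω) (a t ω)) u with hψ'
    have hψ'm : Measurable[history U X t] ψ' :=
      measurable_gaussianCharFun hmm' hPm' measurable_const
    have hψ'b : ∀ ω, ‖ψ' ω‖ ≤ 1 := fun ω =>
      norm_gaussianCharFun_le_one _ (hB.posSemidef_kalmanCov (t + 1) ω) u
    -- `V` collects the coefficients of `z t` in `l X_t + ⟨u, z_{t+1}⟩`.
    set V : Ω → EuclVec d := fun ω => Matrix.toEuclideanCLM (𝕜 := ℝ) Γ.transpose u + l • a t ω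
      with hV
    have hVm : Measurable[history U X t] V := by fun_prop
    have hηb : ∀ κ : ℝ, ‖Complex.exp (-(σ ^ 2 * κ ^ 2 / 2 : ℝ))‖ ≤ 1 := fun κ => by
      rw [← Complex.ofReal_neg, ← Complex.ofReal_exp, Complex.norm_real, Real.norm_eq_abs,
        Real.abs_exp, Real.exp_le_one_iff]
      have : 0 ≤ σ ^ 2 * κ ^ 2 / 2 := by positivity
      linarith
    have hQb := norm_gaussianCharFun_le_one 0 hB.posSemidef_Q u
    have le1 : history U X t ≤ history U X t ⊔ MeasurableSpace.comap (z t) inferInstance :=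
      le_sup_left
    have hzm : Measurable[history U X t ⊔ MeasurableSpace.comap (z t) inferInstance] (z t) :=
      (comap_measurable (z t)).mono le_sup_right le_rfl
    -- Integrate out `ξ t`, then `η t` at frequency `l`, then `z t` in the direction `V` by the
    -- induction hypothesis.
    have lhs : ∫ ω, B.indicator (fun _ => (1 : ℂ)) ω * (Complex.exp (l * X t ω * Complex.I) *
          Complex.exp (inner ℝ u (z (t + 1) ω) * Complex.I)) ∂μ =
        ∫ ω, B.indicator (fun _ => (1 : ℂ)) ω * (gaussianCharFun 0 Q u *
          Complex.exp (-(σ ^ 2 * l ^ 2 / 2 : ℝ))) * gaussianCharFun (m ω) (P ω) (V ω) ∂μ := by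
      have hw1 : Measurable[history U X t ⊔ MeasurableSpace.comap (z t) inferInstance]
          fun ω => B.indicator (fun _ => (1 : ℂ)) ω *
            Complex.exp (inner ℝ (V ω) (z t ω) * Complex.I) := by
        have h1 := h1m.mono le1 le_rfl
        have h2 := hVm.mono le1 le_rfl
        fun_prop
      have hw1b : ∀ ω, ‖B.indicator (fun _ => (1 : ℂ)) ω *
            Complex.exp (inner ℝ (V ω) (z t ω) * Complex.I)‖ ≤ 1 :=
        hprod (norm_indicator_one_le B) fun ω => norm_cexp_real_mul_I _
      have hw2 : Measurable[history U X t ⊔ MeasurableSpace.comap (z t) inferInstance ⊔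
          MeasurableSpace.comap (η t) inferInstance]
          fun ω => B.indicator (fun _ => (1 : ℂ)) ω *
            Complex.exp (inner ℝ (V ω) (z t ω) * Complex.I) *
            Complex.exp ((l * η t ω : ℝ) * Complex.I) := by
        have h1 := hw1.mono (le_sup_left (b := MeasurableSpace.comap (η t) inferInstance)) le_rfl
        have h2 : Measurable[history U X t ⊔ MeasurableSpace.comap (z t) inferInstance ⊔
          MeasurableSpace.comap (η t) inferInstance] (η t) :=
          (comap_measurable (η t)).mono le_sup_right le_rfl
        exact h1.mul (by fun_prop)
      have s1 := hB.integral_mul_cexp_ξ t hw2 (hprod hw1b fun ω => norm_cexp_real_mul_I _) u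
      have s2 := hB.integral_mul_cexp_η t (hw1.mul_const (gaussianCharFun 0 Q u))
        (hprod hw1b fun _ => hQb) (measurable_const (a := l))
      have s3 := hB.integral_mul_cexp_state t ih (W := fun ω => B.indicator (fun _ => (1 : ℂ)) ω *
        (gaussianCharFun 0 Q u * Complex.exp (-(σ ^ 2 * l ^ 2 / 2 : ℝ)))) (h1m.mul_const _)
        (hprod (norm_indicator_one_le B) (hprod (fun _ => hQb) fun _ => hηb l)) hVm
      rw [← s3]
      trans ∫ ω, B.indicator (fun _ => (1 : ℂ)) ω *
            Complex.exp (inner ℝ (V ω) (z t ω) * Complex.I) *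
            Complex.exp ((l * η t ω : ℝ) * Complex.I) *
            Complex.exp (inner ℝ u (ξ t ω) * Complex.I) ∂μ
      · refine integral_congr_ae (ae_of_all _ fun ω => ?_)
        simp only [mul_assoc, ← Complex.exp_add]
        congr 2
        have : l * X t ω + inner ℝ u (z (t + 1) ω) =
            inner ℝ (V ω) (z t ω) + l * η t ω + inner ℝ u (ξ t ω) := by
          rw [hB.reward_eq, hB.state_step', inner_add_right, hV, inner_add_left,
            inner_toEuclideanCLM_transpose, real_inner_smul_left]
          ring
        have := congrArg (fun r : ℝ => (r : ℂ)) this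
        push_cast at this ⊢
        linear_combination Complex.I * this
      · rw [s1]
        trans ∫ ω, B.indicator (fun _ => (1 : ℂ)) ω *
            Complex.exp (inner ℝ (V ω) (z t ω) * Complex.I) * gaussianCharFun 0 Q u *
            Complex.exp ((l * η t ω : ℝ) * Complex.I) ∂μ
        · exact integral_congr_ae (ae_of_all _ fun ω => by ring)
        · rw [s2]
          exact integral_congr_ae (ae_of_all _ fun ω => by ring)
    -- Here `ξ t` is absent; `η t` has frequency `l + k`, and `z t` the direction `(l + k) • a t`.
    -- The two results agree pointwise by `gaussianCharFun_update`.
    have rhs : ∫ ω, B.indicator (fun _ => (1 : ℂ)) ω * (Complex.exp (l * X t ω * Complex.I) *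
          gaussianCharFun (kalmanMean Γ Q S₀ σ (fun s => a s ω) (fun s => X s ω) (t + 1))
            (kalmanCov Γ Q S₀ σ (fun s => a s ω) (t + 1)) u) ∂μ =
        ∫ ω, B.indicator (fun _ => (1 : ℂ)) ω * (ψ' ω *
          Complex.exp (-(σ ^ 2 * (l + k ω) ^ 2 / 2 : ℝ))) *
          gaussianCharFun (m ω) (P ω) ((l + k ω) • a t ω) ∂μ := by
      have hw : Measurable[history U X t] fun ω => B.indicator (fun _ => (1 : ℂ)) ω * ψ' ω :=
        h1m.mul hψ'm
      have hwb := hprod (norm_indicator_one_le B) hψ'b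
      have hw1 : Measurable[history U X t ⊔ MeasurableSpace.comap (z t) inferInstance]
          fun ω => B.indicator (fun _ => (1 : ℂ)) ω * ψ' ω *
            Complex.exp (inner ℝ ((l + k ω) • a t ω) (z t ω) * Complex.I) := by
        have h1 := hw.mono le1 le_rfl
        have h2 := ham.mono le1 le_rfl
        have h3 := hkm.mono le1 le_rfl
        exact h1.mul (by fun_prop)
      have s1 := hB.integral_mul_cexp_η t hw1 (hprod hwb fun ω => norm_cexp_real_mul_I _)
        (κ := fun ω => l + k ω) ((hkm.const_add l).mono le1 le_rfl)
      have s2 := hB.integral_mul_cexp_state t ih (W := fun ω => B.indicator (fun _ => (1 : ℂ)) ω *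
        (ψ' ω * Complex.exp (-(σ ^ 2 * (l + k ω) ^ 2 / 2 : ℝ))))
        (h1m.mul (hψ'm.mul (by fun_prop)))
        (hprod (norm_indicator_one_le B) (hprod hψ'b fun _ => hηb _))
        (V := fun ω => (l + k ω) • a t ω) (by fun_prop)
      rw [← s2]
      trans ∫ ω, B.indicator (fun _ => (1 : ℂ)) ω * ψ' ω *
            Complex.exp (inner ℝ ((l + k ω) • a t ω) (z t ω) * Complex.I) *
            Complex.exp (((l + k ω) * η t ω : ℝ) * Complex.I) ∂μ
      · refine integral_congr_ae (ae_of_all _ fun ω => ?_)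
        simp only [mul_assoc, hψ', gaussianCharFun, ← Complex.exp_add]
        congr 2
        have : l * X t ω + inner ℝ u
            (kalmanMean Γ Q S₀ σ (fun s => a s ω) (fun s => X s ω) (t + 1)) =
            inner ℝ u (m' ω) + inner ℝ ((l + k ω) • a t ω) (z t ω) + (l + k ω) * η t ω := by
          have e : kalmanMean Γ Q S₀ σ (fun s => a s ω) (fun s => X s ω) (t + 1) =
              m' ω + ((quadForm (P ω) (a t ω) + σ ^ 2)⁻¹ * X t ω) • Matrix.toEuclideanCLM (𝕜 := ℝ) Γ
                (Matrix.toEuclideanCLM (𝕜 := ℝ) (P ω) (a t ω)) := by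
            simp only [kalmanMean, hm', hm, hP]
            module
          rw [e, inner_add_right, real_inner_smul_right, real_inner_smul_left,
            ← inner_toEuclideanCLM_transpose, hk, hB.reward_eq]
          ring
        have := congrArg (fun r : ℝ => (r : ℂ)) this
        have e' : kalmanCov Γ Q S₀ σ (fun s => a s ω) (t + 1) =
          riccatiStep Γ Q σ (P ω) (a t ω) := rfl
        rw [e']
        push_cast at this ⊢
        linear_combination Complex.I * this
      · rw [s1]
        exact integral_congr_ae (ae_of_all _ fun ω => by ring)
    rw [lhs, rhs]
    refine integral_congr_ae (ae_of_all _ fun ω => ?_)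
    have := gaussianCharFun_update (Γ := Γ) (Q := Q) (hB.posSemidef_kalmanCov t ω) hB.sigma_pos
      (a t ω) (m ω) u l (k ω) rfl
    simp only [mul_assoc] at this ⊢
    rw [this]

end IsLGDSBandit

/-! ### Gaussian integrals and mixtures -/

section Gaussian

variable {d : ℕ}

lemma integrable_norm_multivariateGaussian (m : EuclVec d) (S : Matrix (Fin d) (Fin d) ℝ) :
    Integrable (fun x => ‖x‖) (multivariateGaussian m S) :=
  (IsGaussian.integrable_id (μ := multivariateGaussian m S)).norm

lemma integrable_norm_sq_multivariateGaussian (m : EuclVec d) (S : Matrix (Fin d) (Fin d) ℝ) :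
    Integrable (fun x => ‖x‖ ^ 2) (multivariateGaussian m S) :=
  (IsGaussian.memLp_two_id (μ := multivariateGaussian m S)).integrable_norm_pow (by norm_num)

lemma integral_norm_multivariateGaussian {S : Matrix (Fin d) (Fin d) ℝ} (hS : S.PosSemidef) :
    ∫ x, ‖x‖ ∂(multivariateGaussian 0 S) = expSqrtQuad S := by
  rw [multivariateGaussian, integral_map (by fun_prop) (by fun_prop), expSqrtQuad]
  simp only [zero_add, norm_toEuclideanCLM_sqrt hS]

lemma integral_apply_mul_apply_multivariateGaussian {S : Matrix (Fin d) (Fin d) ℝ}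
    (hS : S.PosSemidef) (i j : Fin d) :
    ∫ x, x i * x j ∂(multivariateGaussian 0 S) = S i j := by
  have h2 : ∀ i, MemLp (fun x : EuclVec d => x i) 2 (multivariateGaussian 0 S) := fun i =>
    (IsGaussian.memLp_two_id (μ := multivariateGaussian 0 S)).continuousLinearMap_comp
      (EuclideanSpace.proj (𝕜 := ℝ) i)
  have h1 : ∀ i, ∫ x : EuclVec d, x i ∂(multivariateGaussian 0 S) = 0 := fun i => by
    have := (EuclideanSpace.proj (𝕜 := ℝ) i).integral_comp_comm
      (IsGaussian.integrable_id (μ := multivariateGaussian (0 : EuclVec d) S))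
    simpa using this
  have h := covariance_eval_multivariateGaussian (μ := 0) hS i j
  rw [covariance_eq_sub (h2 i) (h2 j), h1, h1] at h
  simpa using h

lemma norm_le_integral_norm_multivariateGaussian (m : EuclVec d)
    (S : Matrix (Fin d) (Fin d) ℝ) : ‖m‖ ≤ ∫ x, ‖x‖ ∂(multivariateGaussian m S) := by
  conv_lhs => rw [← integral_id_multivariateGaussian (μ := m) (S := S)]
  exact norm_integral_le_integral_norm _

lemma integral_inner_multivariateGaussian (v m : EuclVec d) (S : Matrix (Fin d) (Fin d) ℝ) :
    ∫ x, inner ℝ v x ∂(multivariateGaussian m S) = inner ℝ v m := by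
  have h := integral_inner (𝕜 := ℝ)
    (IsGaussian.integrable_id (μ := multivariateGaussian m S)) v
  simpa using h

/-- Integrate `‖x - m‖ ^ 2 ≥ 0`, using that the mean of `x` is `m`. -/
lemma norm_sq_le_integral_norm_sq_multivariateGaussian (m : EuclVec d)
    (S : Matrix (Fin d) (Fin d) ℝ) : ‖m‖ ^ 2 ≤ ∫ x, ‖x‖ ^ 2 ∂(multivariateGaussian m S) := by
  have hi : Integrable (fun x => inner ℝ m x) (multivariateGaussian m S) :=
    (IsGaussian.integrable_id (μ := multivariateGaussian m S)).const_inner m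
  have h : ∫ x, (2 * inner ℝ m x - ‖m‖ ^ 2) ∂(multivariateGaussian m S) ≤
      ∫ x, ‖x‖ ^ 2 ∂(multivariateGaussian m S) := by
    refine integral_mono ((hi.const_mul 2).sub (integrable_const _))
      (integrable_norm_sq_multivariateGaussian m S) fun x => ?_
    have := sq_nonneg ‖x - m‖
    rw [norm_sub_sq_real, real_inner_comm] at this
    dsimp only
    linarith
  rw [integral_sub (hi.const_mul 2) (integrable_const _), integral_const_mul,
    integral_inner_multivariateGaussian, real_inner_self_eq_norm_sq] at h
  simp only [integral_const, probReal_univ, one_smul] at h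
  linarith

open scoped MatrixOrder in
-- If the form vanishes almost everywhere, then `P^{1/2} v = 0` almost surely, so `N(0, P)` is the
-- point mass at `0` and its covariance `P` vanishes.
lemma eq_zero_of_quadForm_ae_eq_zero {P : Matrix (Fin d) (Fin d) ℝ} (hP : P.PosSemidef)
    (h : ∀ᵐ v ∂(stdGaussian (EuclVec d)), quadForm P v = 0) : P = 0 := by
  ext i j
  rw [← integral_apply_mul_apply_multivariateGaussian hP, multivariateGaussian,
    integral_map (by fun_prop) (by fun_prop)]
  refine integral_eq_zero_of_ae ?_
  filter_upwards [h] with v hv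
  have h0 : Matrix.toEuclideanCLM (𝕜 := ℝ) (CFC.sqrt P) v = 0 := by
    rw [← norm_eq_zero, norm_toEuclideanCLM_sqrt hP, hv, Real.sqrt_zero]
  rw [h0]
  simp

/-- The modulus is `exp(-uᵀ S u / 2)`. This serves for differences such as `Z_t - P'`, whose formal
Gaussian characteristic functions arise as averages or limits of quantities of modulus at most one.
-/
lemma posSemidef_of_norm_gaussianCharFun_le_one {S : Matrix (Fin d) (Fin d) ℝ}
    (hS : S.IsHermitian) (h : ∀ u, ‖gaussianCharFun 0 S u‖ ≤ 1) : S.PosSemidef := by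
  refine posSemidef_iff_quadForm_nonneg.2 ⟨hS, fun u => ?_⟩
  have := h u
  rw [norm_gaussianCharFun, Real.exp_le_one_iff] at this
  linarith

/-- A Gaussian vector whose mean and covariance matrix are themselves random: for `p = (ω, w)` with
`w` standard Gaussian, this is `m ω + C(ω)^{1/2} w`. -/
noncomputable def gaussianMixture {Ω : Type*} (m : Ω → EuclVec d)
    (C : Ω → Matrix (Fin d) (Fin d) ℝ) (p : Ω × EuclVec d) : EuclVec d :=
  m p.1 + Matrix.toEuclideanCLM (𝕜 := ℝ) (psdSqrt (C p.1)) p.2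

lemma integral_gaussianMixture_slice {Ω : Type*} {m : Ω → EuclVec d}
    {C : Ω → Matrix (Fin d) (Fin d) ℝ} {F : Type*} [NormedAddCommGroup F] [NormedSpace ℝ F]
    {f : EuclVec d → F} (hf : Continuous f) (ω : Ω) :
    ∫ w, f (gaussianMixture m C (ω, w)) ∂(stdGaussian (EuclVec d)) =
      ∫ x, f x ∂(multivariateGaussian (m ω) (C ω)) := by
  rw [multivariateGaussian, integral_map (by fun_prop) hf.aestronglyMeasurable]
  rfl

section Mixture

variable {Ω : Type*} [MeasurableSpace Ω] {μ : Measure Ω} [IsProbabilityMeasure μ]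
  {m : Ω → EuclVec d} {C : Ω → Matrix (Fin d) (Fin d) ℝ}

lemma measurable_gaussianMixture (hm : Measurable m) (hC : ∀ i j, Measurable fun ω => C ω i j) :
    Measurable (gaussianMixture m C) := by
  have h := measurable_toEuclideanCLM_apply (M := fun p : Ω × EuclVec d => psdSqrt (C p.1))
    (fun i j => (measurable_sqrt_apply hC i j).comp measurable_fst) measurable_snd
  unfold gaussianMixture
  fun_prop

/-- If a Gaussian mixture with covariance matrices `C` is `N(0, S)`, then its random mean is at most
as large as an `N(0, S)` vector. -/
theorem integral_norm_le_of_gaussian_mixture (hm : Measurable m)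
    (hC : ∀ i j, Measurable fun ω => C ω i j) (hpos : ∀ᵐ ω ∂μ, (C ω).PosSemidef)
    {S : Matrix (Fin d) (Fin d) ℝ} (hS : S.IsHermitian)
    (h : ∀ u, ∫ ω, gaussianCharFun (m ω) (C ω) u ∂μ = gaussianCharFun 0 S u) :
    S.PosSemidef ∧ Integrable m μ ∧ ∫ ω, ‖m ω‖ ∂μ ≤ expSqrtQuad S ∧
      Integrable (fun ω => ‖m ω‖ ^ 2) μ ∧
      ∫ ω, ‖m ω‖ ^ 2 ∂μ ≤ ∫ x, ‖x‖ ^ 2 ∂(multivariateGaussian 0 S) := by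
  have hSp : S.PosSemidef := by
    refine posSemidef_of_norm_gaussianCharFun_le_one hS fun u => ?_
    rw [← h u]
    refine (norm_integral_le_of_norm_le_const (C := 1) ?_).trans (by simp)
    filter_upwards [hpos] with ω hω using norm_gaussianCharFun_le_one _ hω u
  have hy := measurable_gaussianMixture hm hC
  have hlaw : (μ.prod (stdGaussian (EuclVec d))).map (gaussianMixture m C) =
      multivariateGaussian 0 S := by
    have _ := Measure.isProbabilityMeasure_map (μ := μ.prod (stdGaussian (EuclVec d)))
      hy.aemeasurable
    refine Measure.ext_of_charFun (funext fun u => ?_)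
    rw [charFun_multivariateGaussian_eq hSp, ← h u, charFun_apply,
      integral_map hy.aemeasurable (by fun_prop), integral_prod]
    · refine integral_congr_ae ?_
      filter_upwards [hpos] with ω hω
      rw [integral_gaussianMixture_slice
        (f := fun x => Complex.exp (inner ℝ x u * Complex.I)) (by fun_prop),
        ← charFun_multivariateGaussian_eq hω, charFun_apply]
    · exact Integrable.of_bound (by fun_prop) 1 (ae_of_all _ fun p => norm_cexp_real_mul_I _)
  -- Integrals against `N(0, S)` are averages of integrals against the components `N(m ω, C ω)`;
  -- with `‖x‖` and `‖x‖ ^ 2`, Jensen's inequality then applies in each component.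
  have hi : ∀ f : EuclVec d → ℝ, Continuous f → Integrable f (multivariateGaussian 0 S) →
      Integrable (fun ω => ∫ x, f x ∂(multivariateGaussian (m ω) (C ω))) μ ∧
      ∫ ω, ∫ x, f x ∂(multivariateGaussian (m ω) (C ω)) ∂μ =
        ∫ x, f x ∂(multivariateGaussian 0 S) := by
    intro f hf hfi
    rw [← hlaw] at hfi
    have h1 : Integrable (fun p => f (gaussianMixture m C p))
        (μ.prod (stdGaussian (EuclVec d))) :=
      (integrable_map_measure hf.aestronglyMeasurable hy.aemeasurable).1 hfi
    have h2 := h1.integral_prod_left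
    have h3 := integral_prod _ h1
    simp only [integral_gaussianMixture_slice hf] at h2 h3
    refine ⟨h2, ?_⟩
    rw [← h3, ← hlaw, integral_map hy.aemeasurable hf.aestronglyMeasurable]
  obtain ⟨i1, e1⟩ := hi _ continuous_norm (integrable_norm_multivariateGaussian 0 S)
  obtain ⟨i2, e2⟩ := hi (fun x => ‖x‖ ^ 2) (by fun_prop)
    (integrable_norm_sq_multivariateGaussian 0 S)
  have j1 : Integrable m μ := i1.mono' hm.aestronglyMeasurable
    (ae_of_all _ fun ω => norm_le_integral_norm_multivariateGaussian _ _)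
  have j2 : Integrable (fun ω => ‖m ω‖ ^ 2) μ := i2.mono' (by fun_prop)
    (ae_of_all _ fun ω => by
      rw [Real.norm_of_nonneg (by positivity)]
      exact norm_sq_le_integral_norm_sq_multivariateGaussian _ _)
  refine ⟨hSp, j1, ?_, j2, ?_⟩
  · rw [← integral_norm_multivariateGaussian hSp, ← e1]
    exact integral_mono j1.norm i1 fun ω => norm_le_integral_norm_multivariateGaussian _ _
  · rw [← e2]
    exact integral_mono j2 i2 fun ω => norm_sq_le_integral_norm_sq_multivariateGaussian _ _

end Mixture

end Gaussian

/-! ### The law of the state and the regret of one round -/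

namespace IsLGDSBandit

variable {d : ℕ} {Ω S : Type*} [MeasurableSpace Ω] [MeasurableSpace S]
  {μ : Measure Ω} {Γ Q S₀ : Matrix (Fin d) (Fin d) ℝ} {σ : ℝ} {U : Ω → S}
  {z ξ : ℕ → Ω → EuclVec d} {η : ℕ → Ω → ℝ} {a : ℕ → Ω → EuclVec d} {X : ℕ → Ω → ℝ}

/-- By induction: `ξ t` is independent of `z t`, so `Γ z_t + ξ_t` is centred Gaussian with
covariance `Γ M Γᵀ + Q`. -/
lemma exists_law_state [IsProbabilityMeasure μ] (hB : IsLGDSBandit μ Γ Q S₀ σ U z ξ η a X)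
    (t : ℕ) : ∃ M : Matrix (Fin d) (Fin d) ℝ, M.PosSemidef ∧
      μ.map (z t) = multivariateGaussian 0 M := by
  induction t with
  | zero => exact ⟨S₀, hB.posSemidef_S₀, hB.law_z₀.map_eq⟩
  | succ t ih =>
    obtain ⟨M, hM, hlaw⟩ := ih
    have hM' : (Γ * M * Γ.transpose + Q).PosSemidef := by
      refine Matrix.PosSemidef.add ?_ hB.posSemidef_Q
      simpa [Matrix.conjTranspose_eq_transpose_of_trivial] using
        hM.mul_mul_conjTranspose_same Γ
    refine ⟨_, hM', ?_⟩
    have hzm := hB.measurable_state t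
    have hzm' := hB.measurable_state (t + 1)
    have _ := Measure.isProbabilityMeasure_map (μ := μ) hzm'.aemeasurable
    refine Measure.ext_of_charFun (funext fun u => ?_)
    rw [charFun_multivariateGaussian_eq hM', charFun_apply,
      integral_map hzm'.aemeasurable (by fun_prop)]
    have hW : Measurable[history U X t ⊔ MeasurableSpace.comap (z t) inferInstance ⊔
        MeasurableSpace.comap (η t) inferInstance]
        fun ω => Complex.exp (inner ℝ (Matrix.toEuclideanCLM (𝕜 := ℝ) Γ.transpose u) (z t ω) *
          Complex.I) := by
      have : Measurable[history U X t ⊔ MeasurableSpace.comap (z t) inferInstance ⊔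
        MeasurableSpace.comap (η t) inferInstance] (z t) :=
        (comap_measurable (z t)).mono (le_sup_of_le_left le_sup_right) le_rfl
      fun_prop
    have s := hB.integral_mul_cexp_ξ t hW (fun _ => norm_cexp_real_mul_I _) u
    trans ∫ ω, Complex.exp (inner ℝ (Matrix.toEuclideanCLM (𝕜 := ℝ) Γ.transpose u) (z t ω) *
          Complex.I) * Complex.exp (inner ℝ u (ξ t ω) * Complex.I) ∂μ
    · refine integral_congr_ae (ae_of_all _ fun ω => ?_)
      simp only [← Complex.exp_add]
      rw [hB.state_step', real_inner_comm, inner_add_right, inner_toEuclideanCLM_transpose]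
      push_cast
      ring_nf
    · rw [s, integral_mul_const]
      have h := charFun_apply (μ := μ.map (z t)) (Matrix.toEuclideanCLM (𝕜 := ℝ) Γ.transpose u)
      rw [integral_map hzm.aemeasurable (by fun_prop), hlaw,
        charFun_multivariateGaussian_eq hM] at h
      simp only [real_inner_comm (Matrix.toEuclideanCLM (𝕜 := ℝ) Γ.transpose u)] at h
      rw [← h]
      simp only [gaussianCharFun, ← Complex.exp_add, inner_zero_right, quadForm_add,
        quadForm_mul_mul_transpose]
      congr 1
      push_cast
      ring

lemma law_state [IsProbabilityMeasure μ] (hB : IsLGDSBandit μ Γ Q S₀ σ U z ξ η a X) (t : ℕ) :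
    (stateCov μ z t).PosSemidef ∧ μ.map (z t) = multivariateGaussian 0 (stateCov μ z t) := by
  obtain ⟨M, hM, hlaw⟩ := hB.exists_law_state t
  suffices stateCov μ z t = M by rw [this]; exact ⟨hM, hlaw⟩
  ext i j
  rw [← integral_apply_mul_apply_multivariateGaussian hM, ← hlaw,
    integral_map (hB.measurable_state t).aemeasurable (by fun_prop)]
  rfl

lemma integrable_state [IsProbabilityMeasure μ] (hB : IsLGDSBandit μ Γ Q S₀ σ U z ξ η a X)
    (t : ℕ) : Integrable (z t) μ := by
  have h := IsGaussian.integrable_id (μ := multivariateGaussian 0 (stateCov μ z t))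
  rw [← (hB.law_state t).2] at h
  exact (integrable_map_measure (by fun_prop) (hB.measurable_state t).aemeasurable).1 h

lemma integral_norm_state [IsProbabilityMeasure μ] (hB : IsLGDSBandit μ Γ Q S₀ σ U z ξ η a X)
    (t : ℕ) : ∫ ω, ‖z t ω‖ ∂μ = expSqrtQuad (stateCov μ z t) := by
  rw [← integral_norm_multivariateGaussian (hB.law_state t).1, ← (hB.law_state t).2,
    integral_map (hB.measurable_state t).aemeasurable (by fun_prop)]

lemma bestReward_eq (hB : IsLGDSBandit μ Γ Q S₀ σ U z ξ η a X) (t : ℕ) (ω : Ω) :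
    bestReward z t ω = ‖z t ω‖ := by
  -- A chosen action is a point of the sphere, which would be empty for `d = 0`.
  have hne : Nonempty (Metric.sphere (0 : EuclVec d) 1) := ⟨⟨a t ω, hB.action_mem t ω⟩⟩
  have hle : ∀ v : Metric.sphere (0 : EuclVec d) 1, inner ℝ (v : EuclVec d) (z t ω) ≤ ‖z t ω‖ :=
    fun v => (real_inner_le_norm _ _).trans_eq (by simp)
  refine le_antisymm (ciSup_le hle) ?_
  have hbdd : BddAbove (Set.range fun v : Metric.sphere (0 : EuclVec d) 1 =>
      inner ℝ (v : EuclVec d) (z t ω)) := ⟨‖z t ω‖, by rintro _ ⟨v, rfl⟩; exact hle v⟩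
  by_cases hz : z t ω = 0
  · simp [bestReward, hz]
  · have hn : ‖z t ω‖ ≠ 0 := norm_ne_zero_iff.2 hz
    refine le_trans (le_of_eq ?_)
      (le_ciSup hbdd ⟨‖z t ω‖⁻¹ • z t ω, by simp [norm_smul, hn]⟩)
    rw [real_inner_smul_left, real_inner_self_eq_norm_sq]
    field_simp

lemma integrable_inner_action [IsProbabilityMeasure μ]
    (hB : IsLGDSBandit μ Γ Q S₀ σ U z ξ η a X) (t : ℕ) {f : Ω → EuclVec d} (hf : Integrable f μ) :
    Integrable (fun ω => inner ℝ (a t ω) (f ω)) μ := by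
  refine hf.norm.mono' ((hB.measurable_action t).aestronglyMeasurable.inner hf.1)
    (ae_of_all _ fun ω => (norm_inner_le_norm _ _).trans ?_)
  simp [mem_sphere_zero_iff_norm.1 (hB.action_mem t ω)]

lemma integrable_η (hB : IsLGDSBandit μ Γ Q S₀ σ U z ξ η a X) (t : ℕ) : Integrable (η t) μ := by
  have h := IsGaussian.integrable_id (μ := gaussianReal 0 (Real.toNNReal (σ ^ 2)))
  rw [← (hB.law_η t).map_eq] at h
  exact (integrable_map_measure (by fun_prop) (hB.measurable_η t).aemeasurable).1 h

lemma integral_η (hB : IsLGDSBandit μ Γ Q S₀ σ U z ξ η a X) (t : ℕ) : ∫ ω, η t ω ∂μ = 0 := by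
  have h := integral_id_gaussianReal (μ := 0) (v := Real.toNNReal (σ ^ 2))
  rw [← (hB.law_η t).map_eq] at h
  rwa [integral_map (hB.measurable_η t).aemeasurable (by fun_prop)] at h

lemma integrable_instantaneous_regret [IsProbabilityMeasure μ]
    (hB : IsLGDSBandit μ Γ Q S₀ σ U z ξ η a X) (t : ℕ) :
    Integrable (fun ω => bestReward z t ω - X t ω) μ := by
  simp only [hB.bestReward_eq, hB.reward_eq]
  exact (hB.integrable_state t).norm.sub
    ((hB.integrable_inner_action t (hB.integrable_state t)).add (hB.integrable_η t))

/-- The characteristic function of the state, as a mixture of those of the filter's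
conditional distributions. -/
lemma integral_gaussianCharFun_kalman [IsProbabilityMeasure μ]
    (hB : IsLGDSBandit μ Γ Q S₀ σ U z ξ η a X) (t : ℕ) (u : EuclVec d) :
    ∫ ω, gaussianCharFun (kalmanMean Γ Q S₀ σ (fun s => a s ω) (fun s => X s ω) t)
        (kalmanCov Γ Q S₀ σ (fun s => a s ω) t) u ∂μ = gaussianCharFun 0 (stateCov μ z t) u := by
  have h := hB.hasCondCharFun_state t u Set.univ .univ
  simp only [Measure.restrict_univ] at h
  rw [← h, ← charFun_multivariateGaussian_eq (hB.law_state t).1, ← (hB.law_state t).2,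
    charFun_apply, integral_map (hB.measurable_state t).aemeasurable (by fun_prop)]
  simp only [real_inner_comm u]

/-- The mixture bound with nothing subtracted from the covariances. The second moment provides the
uniform integrability needed in the limit. -/
lemma kalmanMean_moments [IsProbabilityMeasure μ] (hB : IsLGDSBandit μ Γ Q S₀ σ U z ξ η a X)
    (t : ℕ) :
    Integrable (fun ω => kalmanMean Γ Q S₀ σ (fun s => a s ω) (fun s => X s ω) t) μ ∧
    Integrable (fun ω => ‖kalmanMean Γ Q S₀ σ (fun s => a s ω) (fun s => X s ω) t‖ ^ 2) μ ∧
      ∫ ω, ‖kalmanMean Γ Q S₀ σ (fun s => a s ω) (fun s => X s ω) t‖ ^ 2 ∂μ ≤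
        (stateCov μ z t).trace := by
  obtain ⟨hS, h1, -, h2, h3⟩ := integral_norm_le_of_gaussian_mixture
    ((hB.measurable_kalmanMean t).mono (hB.history_le t) le_rfl)
    (fun i j => (hB.measurable_kalmanCov t i j).mono (hB.history_le t) le_rfl)
    (ae_of_all _ (hB.posSemidef_kalmanCov t)) (hB.law_state t).1.isHermitian
    (hB.integral_gaussianCharFun_kalman t)
  refine ⟨h1, h2, h3.trans_eq ?_⟩
  have hi : ∀ i, Integrable (fun x : EuclVec d => x i ^ 2)
      (multivariateGaussian 0 (stateCov μ z t)) := fun i =>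
    (integrable_norm_sq_multivariateGaussian 0 (stateCov μ z t)).mono' (by fun_prop)
      (ae_of_all _ fun x => by
        rw [norm_pow]
        exact pow_le_pow_left₀ (norm_nonneg _) (PiLp.norm_apply_le x i) 2)
  simp only [EuclideanSpace.real_norm_sq_eq]
  rw [integral_finsetSum _ fun i _ => hi i, Matrix.trace]
  refine Finset.sum_congr rfl fun i _ => ?_
  simp only [sq, Matrix.diag_apply]
  exact integral_apply_mul_apply_multivariateGaussian hS i i

/-- The tower property, obtained through laws: with `w` an independent standard Gaussian, `⟨a_t,
z_t⟩` and `⟨a_t, m_t + P_t^{1/2} w⟩` have the same characteristic function. Integrating out `w` in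
the latter leaves `⟨a_t, m_t⟩`. -/
lemma integral_inner_action_state [IsProbabilityMeasure μ]
    (hB : IsLGDSBandit μ Γ Q S₀ σ U z ξ η a X) (t : ℕ) :
    ∫ ω, inner ℝ (a t ω) (z t ω) ∂μ = ∫ ω, inner ℝ (a t ω)
      (kalmanMean Γ Q S₀ σ (fun s => a s ω) (fun s => X s ω) t) ∂μ := by
  set m : Ω → EuclVec d := fun ω => kalmanMean Γ Q S₀ σ (fun s => a s ω) (fun s => X s ω) t
  set C : Ω → Matrix (Fin d) (Fin d) ℝ := fun ω => kalmanCov Γ Q S₀ σ (fun s => a s ω) t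
  have hzm := hB.measurable_state t
  have ham := hB.measurable_action t
  have hy : Measurable (gaussianMixture m C) := measurable_gaussianMixture
    ((hB.measurable_kalmanMean t).mono (hB.history_le t) le_rfl)
    (fun i j => (hB.measurable_kalmanCov t i j).mono (hB.history_le t) le_rfl)
  have hay : Measurable fun p : Ω × EuclVec d => inner ℝ (a t p.1) (gaussianMixture m C p) := by
    fun_prop
  have haz : Measurable fun ω => inner ℝ (a t ω) (z t ω) := by fun_prop
  have hlaw : μ.map (fun ω => inner ℝ (a t ω) (z t ω)) = (μ.prod (stdGaussian (EuclVec d))).map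
      (fun p => inner ℝ (a t p.1) (gaussianMixture m C p)) := by
    have _ := Measure.isProbabilityMeasure_map (μ := μ) haz.aemeasurable
    have _ := Measure.isProbabilityMeasure_map (μ := μ.prod (stdGaussian (EuclVec d)))
      hay.aemeasurable
    refine Measure.ext_of_charFun (funext fun l => ?_)
    rw [charFun_apply_real, charFun_apply_real, integral_map haz.aemeasurable (by fun_prop),
      integral_map hay.aemeasurable (by fun_prop), integral_prod]
    · have h := hB.integral_mul_cexp_state t (hB.hasCondCharFun_state t) (W := fun _ => 1)
        measurable_const (by simp) (V := fun ω => l • a t ω)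
        ((hB.action_adapted t).const_smul l)
      simp only [one_mul, real_inner_smul_left, Complex.ofReal_mul] at h
      rw [h]
      refine integral_congr_ae (ae_of_all _ fun ω => ?_)
      dsimp only
      rw [integral_gaussianMixture_slice
        (f := fun x => Complex.exp (l * (inner ℝ (a t ω) x : ℝ) * Complex.I)) (by fun_prop),
        ← charFun_multivariateGaussian_eq (hB.posSemidef_kalmanCov t ω), charFun_apply]
      simp only [real_inner_smul_right, Complex.ofReal_mul, real_inner_comm (a t ω)]
      rfl
    · exact Integrable.of_bound (by fun_prop) 1 (ae_of_all _ fun p => by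
        simpa using norm_cexp_real_mul_I (l * inner ℝ (a t p.1) (gaussianMixture m C p)))
  -- Integrability on the product space is inherited through the common law.
  have hi : Integrable (fun p : Ω × EuclVec d => inner ℝ (a t p.1) (gaussianMixture m C p))
      (μ.prod (stdGaussian (EuclVec d))) := by
    have := (integrable_map_measure (f := fun ω => inner ℝ (a t ω) (z t ω))
      (g := fun x : ℝ => x) (by fun_prop) haz.aemeasurable).2
      (hB.integrable_inner_action t (hB.integrable_state t))
    rw [hlaw] at this
    exact (integrable_map_measure (by fun_prop) hay.aemeasurable).1 this
  have e := integral_map (φ := fun ω => inner ℝ (a t ω) (z t ω)) (μ := μ) haz.aemeasurable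
    (f := fun x : ℝ => x) (by fun_prop)
  rw [hlaw, integral_map hay.aemeasurable (by fun_prop), integral_prod _ hi] at e
  rw [← e]
  refine integral_congr_ae (ae_of_all _ fun ω => ?_)
  dsimp only
  rw [integral_gaussianMixture_slice (f := fun x => inner ℝ (a t ω) x) (by fun_prop),
    integral_inner_multivariateGaussian]

/-- The regret of a round is at least the gap between the expected norms of the state and of its
conditional mean. -/
lemma le_instantaneous_regret [IsProbabilityMeasure μ]
    (hB : IsLGDSBandit μ Γ Q S₀ σ U z ξ η a X) (t : ℕ) :
    expSqrtQuad (stateCov μ z t) -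
        ∫ ω, ‖kalmanMean Γ Q S₀ σ (fun s => a s ω) (fun s => X s ω) t‖ ∂μ ≤
      ∫ ω, (bestReward z t ω - X t ω) ∂μ := by
  have hz := hB.integrable_state t
  have hm := (hB.kalmanMean_moments t).1
  have haz := hB.integrable_inner_action t hz
  have hX : ∫ ω, X t ω ∂μ = ∫ ω, inner ℝ (a t ω) (z t ω) ∂μ := by
    simp only [hB.reward_eq]
    rw [integral_add haz (hB.integrable_η t), hB.integral_η, add_zero]
  have hXi : Integrable (X t) μ := by
    rw [funext (hB.reward_eq t)]
    exact haz.add (hB.integrable_η t)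
  simp only [hB.bestReward_eq]
  rw [integral_sub hz.norm hXi, hX, hB.integral_norm_state, hB.integral_inner_action_state]
  refine sub_le_sub_left (integral_mono (hB.integrable_inner_action t hm) hm.norm fun ω => ?_) _
  refine (real_inner_le_norm _ _).trans_eq ?_
  simp [mem_sphere_zero_iff_norm.1 (hB.action_mem t ω)]

end IsLGDSBandit

/-! ### Continuity and monotonicity of `expSqrtQuad` -/

section ExpSqrtQuad

variable {d : ℕ}

lemma abs_quadForm_le (M : Matrix (Fin d) (Fin d) ℝ) (v : EuclVec d) :
    |quadForm M v| ≤ (∑ i, ∑ j, |M i j|) * ‖v‖ ^ 2 := by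
  rw [quadForm_eq_sum, Finset.sum_mul]
  refine (Finset.abs_sum_le_sum_abs _ _).trans (Finset.sum_le_sum fun i _ => ?_)
  rw [Finset.sum_mul]
  refine (Finset.abs_sum_le_sum_abs _ _).trans (Finset.sum_le_sum fun j _ => ?_)
  have hi : |v i| ≤ ‖v‖ := PiLp.norm_apply_le v i
  have hj : |v j| ≤ ‖v‖ := PiLp.norm_apply_le v j
  rw [abs_mul, abs_mul, sq]
  calc |v i| * (|M i j| * |v j|) = |M i j| * (|v i| * |v j|) := by ring
    _ ≤ |M i j| * (‖v‖ * ‖v‖) := by gcongr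

lemma sqrt_quadForm_le (M : Matrix (Fin d) (Fin d) ℝ) (v : EuclVec d) :
    √(quadForm M v) ≤ √(∑ i, ∑ j, |M i j|) * ‖v‖ := by
  refine (Real.sqrt_le_sqrt ((le_abs_self _).trans (abs_quadForm_le M v))).trans_eq ?_
  rw [Real.sqrt_mul (by positivity), Real.sqrt_sq (norm_nonneg v)]

lemma integrable_norm_stdGaussian :
    Integrable (fun v => ‖v‖) (stdGaussian (EuclVec d)) :=
  (IsGaussian.integrable_id (μ := stdGaussian (EuclVec d))).norm

lemma integrable_sqrt_quadForm (M : Matrix (Fin d) (Fin d) ℝ) :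
    Integrable (fun v => √(quadForm M v)) (stdGaussian (EuclVec d)) :=
  (integrable_norm_stdGaussian.const_mul (√(∑ i, ∑ j, |M i j|))).mono' (by fun_prop)
    (ae_of_all _ fun v => by
      rw [Real.norm_of_nonneg (Real.sqrt_nonneg _)]
      exact sqrt_quadForm_le M v)

lemma tendsto_expSqrtQuad {M : ℕ → Matrix (Fin d) (Fin d) ℝ} {N : Matrix (Fin d) (Fin d) ℝ}
    (h : Tendsto M atTop (𝓝 N)) :
    Tendsto (fun t => expSqrtQuad (M t)) atTop (𝓝 (expSqrtQuad N)) := by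
  have hc : Continuous fun M : Matrix (Fin d) (Fin d) ℝ => ∑ i, ∑ j, |M i j| := by fun_prop
  -- Eventually the entry sums of `M t` stay below that of `N` plus one, which yields a single
  -- dominating function.
  have hb := ((hc.tendsto N).comp h).eventually (gt_mem_nhds (lt_add_one _))
  refine tendsto_integral_filter_of_dominated_convergence
    (fun v => √(∑ i, ∑ j, |N i j| + 1) * ‖v‖)
    (.of_forall fun t => (integrable_sqrt_quadForm _).1) ?_
    (integrable_norm_stdGaussian.const_mul _) (ae_of_all _ fun v => ?_)
  · filter_upwards [hb] with t ht
    refine ae_of_all _ fun v => ?_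
    rw [Real.norm_of_nonneg (Real.sqrt_nonneg _)]
    exact (sqrt_quadForm_le _ v).trans (by gcongr; exact ht.le)
  · exact (Real.continuous_sqrt.tendsto _).comp (((continuous_quadForm_left v).tendsto N).comp h)

/-- The map `x ↦ √x - √(x - p)` is antitone. -/
lemma sqrt_sub_sqrt_sub_le {x y p : ℝ} (hp : 0 ≤ p) (hpx : p ≤ x) (hxy : x ≤ y) :
    √y - √(y - p) ≤ √x - √(x - p) := by
  have h1 := Real.sq_sqrt (show 0 ≤ x by linarith)
  have h2 := Real.sq_sqrt (show 0 ≤ y by linarith)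
  have h3 := Real.sq_sqrt (show 0 ≤ x - p by linarith)
  have h4 := Real.sq_sqrt (show 0 ≤ y - p by linarith)
  have h5 := Real.sqrt_le_sqrt hxy
  have h6 := Real.sqrt_le_sqrt (show x - p ≤ y - p by linarith)
  have h7 := Real.sqrt_nonneg (x - p)
  have h8 := Real.sqrt_le_sqrt (show y - p ≤ y by linarith)
  have h9 := Real.sqrt_le_sqrt (show x - p ≤ x by linarith)
  -- In both `x` and `y`, the difference of roots times their sum equals `p`. The sum is larger for
  -- `y`, so the difference is smaller; a vanishing sum is treated apart.
  rcases (add_nonneg (h7.trans h6) (h7.trans h9 |>.trans h5)).eq_or_lt with h0 | h0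
  · have : √y = 0 := by linarith
    linarith
  · by_contra! hlt
    nlinarith [mul_pos (sub_pos.2 hlt) h0]

/-- Pointwise in `v` this is `sqrt_sub_sqrt_sub_le`. It allows `Z_t` to be replaced by an upper
bound `Z` in the exact regret bound. -/
lemma expSqrtQuad_sub_anti {Z Z' P : Matrix (Fin d) (Fin d) ℝ} (hP : P.PosSemidef)
    (hZP : (Z' - P).PosSemidef) (hZ : (Z - Z').PosSemidef) :
    expSqrtQuad Z - expSqrtQuad (Z - P) ≤ expSqrtQuad Z' - expSqrtQuad (Z' - P) := by
  simp only [expSqrtQuad]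
  rw [← integral_sub (integrable_sqrt_quadForm _) (integrable_sqrt_quadForm _),
    ← integral_sub (integrable_sqrt_quadForm _) (integrable_sqrt_quadForm _)]
  refine integral_mono ((integrable_sqrt_quadForm _).sub (integrable_sqrt_quadForm _))
    ((integrable_sqrt_quadForm _).sub (integrable_sqrt_quadForm _)) fun v => ?_
  have h1 := hP.quadForm_nonneg v
  have h2 := hZP.quadForm_nonneg v
  have h3 := hZ.quadForm_nonneg v
  simp only [quadForm_sub] at h2 h3 ⊢
  exact sqrt_sub_sqrt_sub_le h1 (by linarith) (by linarith)

/-- The integrand is nonnegative; if its integral were zero, `vᵀ P v` would vanish almost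
everywhere, forcing `P = 0`. -/
lemma expSqrtQuad_sub_pos {Z P : Matrix (Fin d) (Fin d) ℝ} (hP : P.PosSemidef) (hP0 : P ≠ 0)
    (hZP : (Z - P).PosSemidef) : 0 < expSqrtQuad Z - expSqrtQuad (Z - P) := by
  simp only [expSqrtQuad]
  rw [← integral_sub (integrable_sqrt_quadForm _) (integrable_sqrt_quadForm _)]
  have hle : ∀ v, quadForm (Z - P) v ≤ quadForm Z v := fun v => by
    rw [quadForm_sub]
    linarith [hP.quadForm_nonneg v]
  have hnn : ∀ v, 0 ≤ √(quadForm Z v) - √(quadForm (Z - P) v) := fun v =>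
    sub_nonneg.2 (Real.sqrt_le_sqrt (hle v))
  refine lt_of_le_of_ne (integral_nonneg hnn) fun h0 => hP0 ?_
  refine eq_zero_of_quadForm_ae_eq_zero hP ?_
  filter_upwards [(integral_eq_zero_iff_of_nonneg hnn
    ((integrable_sqrt_quadForm _).sub (integrable_sqrt_quadForm _))).1 h0.symm] with v hv
  have h1 := hZP.quadForm_nonneg v
  have h2 : √(quadForm Z v) = √(quadForm (Z - P) v) := sub_eq_zero.1 hv
  rw [Real.sqrt_inj (h1.trans (hle v)) h1, quadForm_sub] at h2
  linarith

end ExpSqrtQuad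

/-! ### Limits of expected norms and of averages -/

section Convergence

variable {d : ℕ} {Ω : Type*} [MeasurableSpace Ω] {μ : Measure Ω} [IsProbabilityMeasure μ]

/-- Random vectors with bounded second moments which converge in distribution to a Gaussian have
asymptotically at most its expected norm. -/
lemma eventually_integral_norm_le {m : ℕ → Ω → EuclVec d} (hm : ∀ t, Measurable (m t))
    (hm1 : ∀ t, Integrable (m t) μ) (hm2 : ∀ t, Integrable (fun ω => ‖m t ω‖ ^ 2) μ) {B : ℝ}
    (hB : ∀ᶠ t in atTop, ∫ ω, ‖m t ω‖ ^ 2 ∂μ ≤ B) {S : Matrix (Fin d) (Fin d) ℝ}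
    (hS : S.PosSemidef)
    (h : ∀ u, Tendsto (fun t => ∫ ω, Complex.exp (inner ℝ u (m t ω) * Complex.I) ∂μ) atTop
      (𝓝 (gaussianCharFun 0 S u))) {ε : ℝ} (hε : 0 < ε) :
    ∀ᶠ t in atTop, ∫ ω, ‖m t ω‖ ∂μ ≤ expSqrtQuad S + ε := by
  let ν : ℕ → ProbabilityMeasure (EuclVec d) := fun t =>
    ⟨μ.map (m t), Measure.isProbabilityMeasure_map (hm t).aemeasurable⟩
  let G : ProbabilityMeasure (EuclVec d) := ⟨multivariateGaussian 0 S, inferInstance⟩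
  have hν : Tendsto ν atTop (𝓝 G) := by
    refine ProbabilityMeasure.tendsto_iff_tendsto_charFun.2 fun u => ?_
    have e : ∀ t, charFun (ν t : Measure (EuclVec d)) u =
        ∫ ω, Complex.exp (inner ℝ u (m t ω) * Complex.I) ∂μ := fun t => by
      change charFun (μ.map (m t)) u = _
      rw [charFun_apply, integral_map (hm t).aemeasurable (by fun_prop)]
      simp only [real_inner_comm u]
    simp only [e]
    change Tendsto _ _ (𝓝 (charFun (multivariateGaussian 0 S) u))
    rw [charFun_multivariateGaussian_eq hS]
    exact h u
  -- Truncation level: `‖x‖ ≤ min ‖x‖ K + ‖x‖ ^ 2 / K`, so the tail costs at most `B / K`. The `1`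
  -- in the maximum keeps `K` positive whatever `B` is.
  obtain ⟨K, hK0, hK⟩ : ∃ K > 0, B / K ≤ ε / 2 := by
    refine ⟨max 1 (2 * B / ε), by positivity, ?_⟩
    rw [div_le_iff₀ (by positivity)]
    have := (div_le_iff₀ hε).1 (le_max_right 1 (2 * B / ε))
    linarith
  let f : BoundedContinuousFunction (EuclVec d) ℝ :=
    BoundedContinuousFunction.ofNormedAddCommGroup (fun x => min ‖x‖ K) (by fun_prop) K fun x => by
      rw [Real.norm_of_nonneg (by positivity)]
      exact min_le_right _ _
  have hf := ProbabilityMeasure.tendsto_iff_forall_integral_tendsto.1 hν f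
  have hfe : ∀ t, ∫ x, f x ∂(ν t : Measure (EuclVec d)) = ∫ ω, min ‖m t ω‖ K ∂μ := fun t =>
    integral_map (hm t).aemeasurable f.continuous.aestronglyMeasurable
  have hfG : ∫ x, f x ∂(G : Measure (EuclVec d)) ≤ expSqrtQuad S := by
    rw [← integral_norm_multivariateGaussian hS]
    exact integral_mono (f.integrable _) (integrable_norm_multivariateGaussian 0 S) fun x =>
      min_le_left _ _
  have hev := hf.eventually (gt_mem_nhds (show ∫ x, f x ∂(G : Measure (EuclVec d)) <
    expSqrtQuad S + ε / 2 by linarith))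
  filter_upwards [hev, hB] with t ht htB
  rw [hfe] at ht
  have hmin : Integrable (fun ω => min ‖m t ω‖ K) μ := Integrable.of_bound (by
      have := hm t
      fun_prop) K (ae_of_all _ fun ω => by
    rw [Real.norm_of_nonneg (by positivity)]
    exact min_le_right _ _)
  have h1 : ∫ ω, ‖m t ω‖ ∂μ ≤ ∫ ω, (min ‖m t ω‖ K + ‖m t ω‖ ^ 2 / K) ∂μ := by
    refine integral_mono (hm1 t).norm (hmin.add ((hm2 t).div_const K)) fun ω => ?_
    dsimp only
    rcases le_total ‖m t ω‖ K with hle | hle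
    · rw [min_eq_left hle]
      have : 0 ≤ ‖m t ω‖ ^ 2 / K := by positivity
      linarith
    · have : ‖m t ω‖ ≤ ‖m t ω‖ ^ 2 / K := by
        rw [le_div_iff₀ hK0, sq]
        gcongr
      have : 0 ≤ min ‖m t ω‖ K := by positivity
      linarith
  rw [integral_add hmin ((hm2 t).div_const K), integral_div] at h1
  have h2 : (∫ ω, ‖m t ω‖ ^ 2 ∂μ) / K ≤ B / K := by gcongr
  linarith

/-- If mixtures of `N(m_t, C_t)` are centred Gaussian with covariances converging to `Z`, and
`C_t → P` almost surely, then `m_t` converges in distribution to `N(0, Z - P)`. -/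
lemma tendsto_charFun_mean {m : ℕ → Ω → EuclVec d} (hm : ∀ t, Measurable (m t))
    {C : ℕ → Ω → Matrix (Fin d) (Fin d) ℝ} (hC : ∀ t i j, Measurable fun ω => C t ω i j)
    (hCp : ∀ t ω, (C t ω).PosSemidef) {M : ℕ → Matrix (Fin d) (Fin d) ℝ}
    {Z P : Matrix (Fin d) (Fin d) ℝ}
    (h : ∀ t u, ∫ ω, gaussianCharFun (m t ω) (C t ω) u ∂μ = gaussianCharFun 0 (M t) u)
    (hM : Tendsto M atTop (𝓝 Z)) (hP : ∀ᵐ ω ∂μ, Tendsto (fun t => C t ω) atTop (𝓝 P))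
    (u : EuclVec d) :
    Tendsto (fun t => ∫ ω, Complex.exp (inner ℝ u (m t ω) * Complex.I) ∂μ) atTop
      (𝓝 (gaussianCharFun 0 (Z - P) u)) := by
  have hq : ∀ t, Measurable fun ω => quadForm (C t ω) u := fun t =>
    measurable_quadForm (hC t) measurable_const
  have hgi : ∀ t, Integrable (fun ω => gaussianCharFun (m t ω) (C t ω) u) μ := fun t =>
    Integrable.of_bound (measurable_gaussianCharFun (hm t) (hC t)
      measurable_const).aestronglyMeasurable 1
      (ae_of_all _ fun ω => norm_gaussianCharFun_le_one _ (hCp t ω) u)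
  have hei : ∀ t, Integrable (fun ω => Complex.exp (inner ℝ u (m t ω) * Complex.I)) μ := fun t =>
    Integrable.of_bound (by
      have := hm t
      fun_prop) 1 (ae_of_all _ fun ω => norm_cexp_real_mul_I _)
  have hlim : Tendsto (fun t => Complex.exp (quadForm P u / 2) * gaussianCharFun 0 (M t) u) atTop
      (𝓝 (gaussianCharFun 0 (Z - P) u)) := by
    have e : gaussianCharFun 0 (Z - P) u =
        Complex.exp (quadForm P u / 2) * gaussianCharFun 0 Z u := by
      simp only [gaussianCharFun, ← Complex.exp_add, quadForm_sub]
      congr 1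
      push_cast
      ring
    rw [e]
    have hc : Continuous fun N : Matrix (Fin d) (Fin d) ℝ => gaussianCharFun 0 N u := by
      have := continuous_quadForm_left u
      unfold gaussianCharFun
      fun_prop
    exact ((hc.tendsto Z).comp hM).const_mul _
  have hdct : Tendsto
      (fun t => ∫ ω, |1 - Real.exp (quadForm P u / 2 - quadForm (C t ω) u / 2)| ∂μ) atTop
      (𝓝 (∫ _ω, (0 : ℝ) ∂μ)) := by
    refine tendsto_integral_of_dominated_convergence (fun _ => 1 + Real.exp (quadForm P u / 2))
      (fun t => ?_) (integrable_const _) (fun t => ae_of_all _ fun ω => ?_) ?_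
    · have := hq t
      exact Measurable.aestronglyMeasurable (by fun_prop)
    · rw [Real.norm_eq_abs, abs_abs]
      refine (abs_sub _ _).trans ?_
      rw [abs_one, Real.abs_exp]
      gcongr
      linarith [(hCp t ω).quadForm_nonneg u]
    · filter_upwards [hP] with ω hω
      have hc : Continuous fun x : ℝ => |1 - Real.exp (quadForm P u / 2 - x / 2)| := by fun_prop
      have := (hc.tendsto _).comp (((continuous_quadForm_left u).tendsto P).comp hω)
      simpa [Function.comp_def] using this
  rw [integral_zero] at hdct
  -- The factor `exp(uᵀ P u / 2)` undoes the damping by `C t` in the limit. The phases have modulus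
  -- one, so the error is the expectation of `|1 - exp((uᵀ P u - uᵀ C_t u) / 2)|`, which vanishes by
  -- dominated convergence.
  have hdiff : Tendsto (fun t => ∫ ω, Complex.exp (inner ℝ u (m t ω) * Complex.I) ∂μ -
      Complex.exp (quadForm P u / 2) * gaussianCharFun 0 (M t) u) atTop (𝓝 0) := by
    refine squeeze_zero_norm (fun t => ?_) hdct
    rw [← h t u, ← integral_const_mul, ← integral_sub (hei t) ((hgi t).const_mul _)]
    refine (norm_integral_le_integral_norm _).trans_eq (integral_congr_ae (ae_of_all _ fun ω => ?_))
    have e : Complex.exp (inner ℝ u (m t ω) * Complex.I) -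
        Complex.exp (quadForm P u / 2) * gaussianCharFun (m t ω) (C t ω) u =
        Complex.exp (inner ℝ u (m t ω) * Complex.I) *
          ((1 - Real.exp (quadForm P u / 2 - quadForm (C t ω) u / 2) : ℝ) : ℂ) := by
      rw [Complex.ofReal_sub, Complex.ofReal_exp, mul_sub, Complex.ofReal_one, mul_one]
      simp only [gaussianCharFun, ← Complex.exp_add]
      congr 2
      push_cast
      ring
    dsimp only
    rw [e, norm_mul, Complex.norm_exp_ofReal_mul_I, one_mul, Complex.norm_real, Real.norm_eq_abs]
  simpa using hdiff.add hlim

end Convergence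

/-- A sequence with `c ≤ liminf r` has partial sums at least `n c - o(n)`. -/
lemma eventually_sum_Icc_ge {r : ℕ → ℝ} {c : ℝ} (h : ∀ ε > 0, ∀ᶠ t in atTop, c - ε ≤ r t)
    {ε : ℝ} (hε : 0 < ε) :
    ∀ᶠ n : ℕ in atTop, ∑ _t ∈ Finset.Icc 1 n, c - ε * n ≤ ∑ t ∈ Finset.Icc 1 n, r t := by
  -- Half of `ε` covers the terms from `T` on; the other half covers the earlier ones, whose total
  -- deficit is at most `K`, as soon as `n ≥ 2 * K / ε`.
  obtain ⟨T, hT⟩ := eventually_atTop.1 (h (ε / 2) (by positivity))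
  set K := ∑ t ∈ Finset.range T, |r t - (c - ε / 2)| with hK
  have key : ∀ n, -K ≤ ∑ t ∈ Finset.Icc 1 n, (r t - (c - ε / 2)) := by
    intro n
    have h1 : ∑ t ∈ Finset.Icc 1 n with t < T, (r t - (c - ε / 2)) ≤
        ∑ t ∈ Finset.Icc 1 n, (r t - (c - ε / 2)) :=
      Finset.sum_le_sum_of_subset_of_nonneg (Finset.filter_subset _ _) fun t ht ht' => by
        have : T ≤ t := not_lt.1 fun hlt => ht' (Finset.mem_filter.2 ⟨ht, hlt⟩)
        linarith [hT t this]
    have h2 : ∑ t ∈ Finset.Icc 1 n with t < T, |r t - (c - ε / 2)| ≤ K :=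
      Finset.sum_le_sum_of_subset_of_nonneg
        (fun t ht => Finset.mem_range.2 (Finset.mem_filter.1 ht).2) fun _ _ _ => abs_nonneg _
    have h3 := neg_le_of_abs_le ((Finset.abs_sum_le_sum_abs (fun t => r t - (c - ε / 2))
      {t ∈ Finset.Icc 1 n | t < T}).trans h2)
    exact h3.trans h1
  filter_upwards [eventually_ge_atTop ⌈2 * K / ε⌉₊] with n hn
  have h1 := key n
  rw [Finset.sum_sub_distrib, Finset.sum_const, Nat.card_Icc, nsmul_eq_mul] at h1
  rw [Finset.sum_const, Nat.card_Icc, nsmul_eq_mul]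
  have h2 : 2 * K / ε ≤ n := (Nat.le_ceil _).trans (by exact_mod_cast hn)
  rw [div_le_iff₀ hε] at h2
  simp only [Nat.add_sub_cancel] at h1 ⊢
  linarith

open scoped MatrixOrder in
-- For `Q = 0` every block of the controllability matrix vanishes, so its rank is `0 < d`.
lemma IsControllable.ne_zero {d : ℕ} (hd : 0 < d) {A Q : Matrix (Fin d) (Fin d) ℝ}
    (h : IsControllable A (psdSqrt Q)) : Q ≠ 0 := by
  rintro rfl
  have h0 : psdSqrt (0 : Matrix (Fin d) (Fin d) ℝ) = 0 := CFC.sqrt_zero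
  have hz : (Matrix.of fun (i : Fin d) (p : Fin d × Fin d) =>
      (A ^ (p.1 : ℕ) * psdSqrt (0 : Matrix (Fin d) (Fin d) ℝ)) i p.2) = 0 := by
    ext i p
    simp [h0]
  rw [IsControllable, hz, Matrix.rank_zero] at h
  omega

/-! ### Regret bounds from bounds and limits of the error covariance -/

namespace IsLGDSBandit

variable {d : ℕ} {Ω S : Type*} [MeasurableSpace Ω] [MeasurableSpace S]
  {μ : Measure Ω} {Γ Q S₀ : Matrix (Fin d) (Fin d) ℝ} {σ : ℝ} {U : Ω → S}
  {z ξ : ℕ → Ω → EuclVec d} {η : ℕ → Ω → ℝ} {a : ℕ → Ω → EuclVec d} {X : ℕ → Ω → ℝ}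

/-- If `P'` bounds the error covariance of round `t` from below, then `Z_t - P'` is positive
semidefinite and bounds the expected norm of the filter's mean. -/
lemma integral_norm_kalmanMean_le [IsProbabilityMeasure μ]
    (hB : IsLGDSBandit μ Γ Q S₀ σ U z ξ η a X) (t : ℕ) {P' : Matrix (Fin d) (Fin d) ℝ}
    (hP' : ∀ᵐ ω ∂μ, (kalmanCov Γ Q S₀ σ (fun s => a s ω) t - P').PosSemidef) :
    (stateCov μ z t - P').PosSemidef ∧
      ∫ ω, ‖kalmanMean Γ Q S₀ σ (fun s => a s ω) (fun s => X s ω) t‖ ∂μ ≤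
        expSqrtQuad (stateCov μ z t - P') := by
  -- Symmetry of `P'` is read off at one sample point, where `P'` is a difference of two symmetric
  -- matrices.
  have hherm : P'.IsHermitian := by
    obtain ⟨ω, hω⟩ := hP'.exists
    simpa using (hB.posSemidef_kalmanCov t ω).isHermitian.sub hω.isHermitian
  have h := integral_norm_le_of_gaussian_mixture (μ := μ) (S := stateCov μ z t - P')
    (C := fun ω => kalmanCov Γ Q S₀ σ (fun s => a s ω) t - P')
    ((hB.measurable_kalmanMean t).mono (hB.history_le t) le_rfl)
    (fun i j => ((hB.measurable_kalmanCov t i j).mono (hB.history_le t) le_rfl).sub_const _)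
    hP' ((hB.law_state t).1.isHermitian.sub hherm) fun u => by
      -- Subtracting the deterministic `P'` multiplies every characteristic function by the same
      -- constant, which leaves the expectation.
      have e : ∀ (m : EuclVec d) M, gaussianCharFun m (M - P') u =
          gaussianCharFun m M u * Complex.exp (quadForm P' u / 2) := fun m M => by
        simp only [gaussianCharFun, ← Complex.exp_add, quadForm_sub]
        congr 1
        push_cast
        ring
      simp only [e]
      rw [integral_mul_const, hB.integral_gaussianCharFun_kalman]
  exact ⟨h.1, h.2.2.1⟩

lemma le_instantaneous_regret_of_le [IsProbabilityMeasure μ]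
    (hB : IsLGDSBandit μ Γ Q S₀ σ U z ξ η a X) (t : ℕ) {P' : Matrix (Fin d) (Fin d) ℝ}
    (hP' : ∀ᵐ ω ∂μ, (kalmanCov Γ Q S₀ σ (fun s => a s ω) t - P').PosSemidef) :
    expSqrtQuad (stateCov μ z t) - expSqrtQuad (stateCov μ z t - P') ≤
      ∫ ω, (bestReward z t ω - X t ω) ∂μ :=
  (sub_le_sub_left (hB.integral_norm_kalmanMean_le t hP').2 _).trans (hB.le_instantaneous_regret t)

section Limit

variable {Z P : Matrix (Fin d) (Fin d) ℝ}

/-- A single path along which the covariances converge suffices: `P_{t|t-1}` is positive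
semidefinite, `P_{t+1|t} ⪰ Q`, and the cone is closed. -/
lemma posSemidef_limit_sub [IsProbabilityMeasure μ] (hB : IsLGDSBandit μ Γ Q S₀ σ U z ξ η a X)
    (hP : ∀ᵐ ω ∂μ, Tendsto (fun t => kalmanCov Γ Q S₀ σ (fun s => a s ω) t) atTop (𝓝 P)) :
    P.PosSemidef ∧ (P - Q).PosSemidef := by
  obtain ⟨ω, hω⟩ := hP.exists
  refine ⟨isClosed_posSemidef.mem_of_tendsto hω (.of_forall fun t => hB.posSemidef_kalmanCov t ω),
    isClosed_posSemidef.mem_of_tendsto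
      (((tendsto_add_atTop_iff_nat 1).2 hω).sub_const Q) (.of_forall fun t => ?_)⟩
  exact posSemidef_kalmanCov_succ_sub hB.posSemidef_S₀ hB.posSemidef_Q hB.sigma_pos _ t

lemma tendsto_charFun_kalmanMean [IsProbabilityMeasure μ]
    (hB : IsLGDSBandit μ Γ Q S₀ σ U z ξ η a X)
    (hZ : Tendsto (fun t => stateCov μ z t) atTop (𝓝 Z))
    (hP : ∀ᵐ ω ∂μ, Tendsto (fun t => kalmanCov Γ Q S₀ σ (fun s => a s ω) t) atTop (𝓝 P))
    (u : EuclVec d) :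
    Tendsto (fun t => ∫ ω, Complex.exp (inner ℝ u
      (kalmanMean Γ Q S₀ σ (fun s => a s ω) (fun s => X s ω) t) * Complex.I) ∂μ) atTop
      (𝓝 (gaussianCharFun 0 (Z - P) u)) :=
  tendsto_charFun_mean
    (fun t => (hB.measurable_kalmanMean t).mono (hB.history_le t) le_rfl)
    (fun t i j => (hB.measurable_kalmanCov t i j).mono (hB.history_le t) le_rfl)
    hB.posSemidef_kalmanCov hB.integral_gaussianCharFun_kalman hZ hP u

/-- `exp(-uᵀ (Z - P) u / 2)` is a limit of characteristic functions of the filter's means, hence of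
modulus at most one. -/
lemma posSemidef_limit_stateCov_sub [IsProbabilityMeasure μ]
    (hB : IsLGDSBandit μ Γ Q S₀ σ U z ξ η a X)
    (hZ : Tendsto (fun t => stateCov μ z t) atTop (𝓝 Z))
    (hP : ∀ᵐ ω ∂μ, Tendsto (fun t => kalmanCov Γ Q S₀ σ (fun s => a s ω) t) atTop (𝓝 P)) :
    (Z - P).PosSemidef := by
  have hZp : Z.PosSemidef := isClosed_posSemidef.mem_of_tendsto hZ
    (.of_forall fun t => (hB.law_state t).1)
  refine posSemidef_of_norm_gaussianCharFun_le_one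
    (hZp.isHermitian.sub (hB.posSemidef_limit_sub hP).1.isHermitian) fun u => ?_
  refine le_of_tendsto (hB.tendsto_charFun_kalmanMean hZ hP u).norm (.of_forall fun t => ?_)
  exact (norm_integral_le_of_norm_le_const (C := 1)
    (ae_of_all _ fun ω => norm_cexp_real_mul_I _)).trans (by simp)

lemma eventually_le_instantaneous_regret [IsProbabilityMeasure μ]
    (hB : IsLGDSBandit μ Γ Q S₀ σ U z ξ η a X)
    (hZ : Tendsto (fun t => stateCov μ z t) atTop (𝓝 Z))
    (hP : ∀ᵐ ω ∂μ, Tendsto (fun t => kalmanCov Γ Q S₀ σ (fun s => a s ω) t) atTop (𝓝 P))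
    {ε : ℝ} (hε : 0 < ε) :
    ∀ᶠ t in atTop, expSqrtQuad Z - expSqrtQuad (Z - P) - ε ≤
      ∫ ω, (bestReward z t ω - X t ω) ∂μ := by
  have htr : ∀ᶠ t in atTop,
      ∫ ω, ‖kalmanMean Γ Q S₀ σ (fun s => a s ω) (fun s => X s ω) t‖ ^ 2 ∂μ ≤ Z.trace + 1 := by
    have hc : Continuous fun M : Matrix (Fin d) (Fin d) ℝ => M.trace := by fun_prop
    filter_upwards [((hc.tendsto Z).comp hZ).eventually (gt_mem_nhds (lt_add_one _))] with t ht
    exact (hB.kalmanMean_moments t).2.2.trans ht.le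
  have h1 := eventually_integral_norm_le
    (fun t => (hB.measurable_kalmanMean t).mono (hB.history_le t) le_rfl)
    (fun t => (hB.kalmanMean_moments t).1) (fun t => (hB.kalmanMean_moments t).2.1) htr
    (hB.posSemidef_limit_stateCov_sub hZ hP) (hB.tendsto_charFun_kalmanMean hZ hP) (half_pos hε)
  have h2 := (tendsto_expSqrtQuad hZ).eventually
    (lt_mem_nhds (show expSqrtQuad Z - ε / 2 < expSqrtQuad Z by linarith))
  filter_upwards [h1, h2] with t ht1 ht2
  linarith [hB.le_instantaneous_regret t]

end Limit

end IsLGDSBandit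

theorem theorem2 {d : ℕ} {Ω S : Type*} [MeasurableSpace Ω] [MeasurableSpace S]
    (μ : Measure Ω) [IsProbabilityMeasure μ]
    (Γ Q S₀ : Matrix (Fin d) (Fin d) ℝ) (σ : ℝ) (U : Ω → S)
    (z ξ : ℕ → Ω → EuclVec d) (η : ℕ → Ω → ℝ) (a : ℕ → Ω → EuclVec d) (X : ℕ → Ω → ℝ)
    (hB : IsLGDSBandit μ Γ Q S₀ σ U z ξ η a X) :
    -- the expectations in the regret are those of integrable random variables
    (∀ t, Integrable (fun ω => bestReward z t ω - X t ω) μ) ∧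
    -- the bound in terms of a lower bound `P'` of the error covariances
    (∀ (n : ℕ) (P' : Matrix (Fin d) (Fin d) ℝ),
      (∀ t ∈ Finset.Icc 1 n,
        ∀ᵐ ω ∂μ, (kalmanCov Γ Q S₀ σ (fun s => a s ω) t - P').PosSemidef) →
      ∑ t ∈ Finset.Icc 1 n,
        (expSqrtQuad (stateCov μ z t) - expSqrtQuad (stateCov μ z t - P')) ≤ regret μ z X n) ∧
    -- the bound in terms of the limits `Z` and `P`
    (∀ Z P : Matrix (Fin d) (Fin d) ℝ,
      spectralRadius ℂ (Γ.map (fun x : ℝ => (x : ℂ))) < 1 →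
      Tendsto (fun t => stateCov μ z t) atTop (𝓝 Z) →
      (∀ᵐ ω ∂μ, Tendsto (fun t => kalmanCov Γ Q S₀ σ (fun s => a s ω) t) atTop (𝓝 P)) →
      -- asymptotically, for every state and filter initialization
      (∀ ε > 0, ∀ᶠ n : ℕ in atTop,
        ∑ _t ∈ Finset.Icc 1 n, (expSqrtQuad Z - expSqrtQuad (Z - P)) - ε * n ≤
          regret μ z X n) ∧
      -- without error term, when the limits bound `Z_t` and `P_{t|t-1}` in rounds `1, …, n`,
      -- in particular in the stationary regime `Z_t = Z`, `P_{t|t-1} = P`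
      (∀ n : ℕ,
        (∀ t ∈ Finset.Icc 1 n, (Z - stateCov μ z t).PosSemidef ∧
          ∀ᵐ ω ∂μ, (kalmanCov Γ Q S₀ σ (fun s => a s ω) t - P).PosSemidef) →
        ∑ _t ∈ Finset.Icc 1 n, (expSqrtQuad Z - expSqrtQuad (Z - P)) ≤ regret μ z X n) ∧
      -- the linear rate is positive under the standing controllability assumption
      (IsControllable Γ (psdSqrt Q) → 0 < expSqrtQuad Z - expSqrtQuad (Z - P))) := by
  refine ⟨hB.integrable_instantaneous_regret, fun n P' hP' =>
    Finset.sum_le_sum fun t ht => hB.le_instantaneous_regret_of_le t (hP' t ht),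
    fun Z P _ hZ hP => ⟨fun ε hε => ?_, fun n hn => ?_, fun hc => ?_⟩⟩
  · exact eventually_sum_Icc_ge (fun ε hε => hB.eventually_le_instantaneous_regret hZ hP hε) hε
  · refine Finset.sum_le_sum fun t ht => ?_
    obtain ⟨h1, h2⟩ := hn t ht
    exact (expSqrtQuad_sub_anti (hB.posSemidef_limit_sub hP).1
      (hB.integral_norm_kalmanMean_le t h2).1 h1).trans (hB.le_instantaneous_regret_of_le t h2)
  · obtain ⟨hPp, hPQ⟩ := hB.posSemidef_limit_sub hP
    refine expSqrtQuad_sub_pos hPp (fun h0 => ?_) (hB.posSemidef_limit_stateCov_sub hZ hP)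
    -- In dimension zero no action has norm one, so the model itself excludes `d = 0`.
    have hd : 0 < d := by
      obtain ⟨ω⟩ := μ.nonempty_of_neZero
      rcases Nat.eq_zero_or_pos d with rfl | h
      · have := hB.action_mem 0 ω
        rw [mem_sphere_zero_iff_norm, Subsingleton.elim (a 0 ω) 0, norm_zero] at this
        exact absurd this zero_ne_one
      · exact h
    refine hc.ne_zero hd ?_
    -- If `P = 0`, then `P ⪰ Q` gives `tr Q ≤ 0`, hence `Q = 0`, which contradicts controllability.
    refine hB.posSemidef_Q.trace_eq_zero_iff.1 (le_antisymm ?_ hB.posSemidef_Q.trace_nonneg)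
    have := hPQ.trace_nonneg
    rw [h0, zero_sub, Matrix.trace_neg] at this
    linarith
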